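/- Let $k$ be a field, $S=k[x_1,\ldots,x_n]$, and let $M\subseteq S$ be a monomial ideal with minimal monomial generating set $G$. Suppose that $M$ is almost generic, that is, there is an index $i\in\{1,\ldots,n\}$ such that no variable $x_j$ with $j\neq i$ appears with the same nonzero exponent in the factorizations of two distinct elements of $G$. Then $M$ has characteristic Betti numbers, that is, for every monomial $l$, \[ \sum_{r\ge 0}\beta_{r,l}(S/M)=\begin{cases}1 & \text{if the number of subsets } T\subseteq G \text{ with } \operatorname{lcm}(T)=l \text{ is odd},\\ 0 & \text{otherwise.}\end{cases} \] Here $\operatorname{lcm}(\varnothing)=1$, so the subsets $T\subseteq G$ with $\operatorname{lcm}(T)=l$ correspond to the basis elements of multidegree $l$ of the Taylor resolution of $S/M$ on $G$; and $\beta_{r,l}(S/M)$ is the multigraded Betti number of $S/M$, that is, the number of basis elements of multidegree $l$ of the $r$-th free module in a minimal multigraded free resolution of $S/M$. -/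

import Mathlib

open MvPolynomial

noncomputable section

/-- A monomial ideal of `k[x_1, …, x_n]`: an ideal generated by a set of monomials. A monomial
is identified with its exponent vector `a : Fin n →₀ ℕ`. -/
def IsMonomialIdeal {k : Type*} [Field k] {n : ℕ} (M : Ideal (MvPolynomial (Fin n) k)) : Prop :=
  ∃ A : Set (Fin n →₀ ℕ), M = Ideal.span ((fun a => monomial a (1 : k)) '' A)

/-- The divisibility-minimal monomials of an ideal are finite in number. -/
theorem finite_minimal_monomials {k : Type*} [Field k] {n : ℕ}
    (M : Ideal (MvPolynomial (Fin n) k)) :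
    {a : Fin n →₀ ℕ | Minimal (fun b => monomial b (1 : k) ∈ M) a}.Finite :=
  WellQuasiOrderedLE.finite_of_isAntichain (setOfPred_minimal_antichain _)

/-- The minimal generating set of a monomial ideal `M`: the monomials of `M` that are minimal
with respect to divisibility. -/
def minimalGenerators {k : Type*} [Field k] {n : ℕ}
    (M : Ideal (MvPolynomial (Fin n) k)) : Finset (Fin n →₀ ℕ) :=
  (finite_minimal_monomials M).toFinset

/-- `M` is almost generic: for some index `i`, no variable other than `x_i` appears with the same
nonzero exponent in two distinct minimal generators of `M`. -/
def IsAlmostGeneric {k : Type*} [Field k] {n : ℕ}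
    (M : Ideal (MvPolynomial (Fin n) k)) : Prop :=
  ∃ i : Fin n, ∀ j : Fin n, j ≠ i →
    ∀ a ∈ minimalGenerators M, ∀ b ∈ minimalGenerators M, a ≠ b → a j ≠ 0 → a j ≠ b j

/-- The multidegree of the Taylor symbol of a finite set `T` of monomials: their least common
multiple (on exponent vectors, the componentwise maximum; it is `1` for the empty symbol). -/
def taylorMultidegree {n : ℕ} (T : Finset (Fin n →₀ ℕ)) : Fin n →₀ ℕ :=
  T.sup id

/-- The number of basis elements of multidegree `l` (in all homological degrees together) of the
Taylor resolution determined by the minimal generating set of `M`. -/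
def taylorCount {k : Type*} [Field k] {n : ℕ} (M : Ideal (MvPolynomial (Fin n) k))
    (l : Fin n →₀ ℕ) : ℕ :=
  ((minimalGenerators M).powerset.filter (fun T => taylorMultidegree T = l)).card

/-- A multigraded free resolution `⋯ → F_2 → F_1 → F_0 → S/M → 0` of `S/M` by free modules of
finite rank, where `S = k[x_1, …, x_n]`. Here `F_i` has the basis `ι i`, its basis elements carry
multidegrees in `ℕⁿ`, and all maps are homogeneous of degree zero. -/
structure MultigradedFreeResolution {k : Type*} [Field k] {n : ℕ}
    (M : Ideal (MvPolynomial (Fin n) k)) where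
  /-- the basis of `F_i` -/
  ι : ℕ → Type
  finite : ∀ i, Finite (ι i)
  /-- the multidegrees of the basis elements -/
  mdeg : ∀ i, ι i → (Fin n →₀ ℕ)
  /-- the differential `F_{i+1} → F_i` -/
  d : ∀ i, (ι (i + 1) →₀ MvPolynomial (Fin n) k) →ₗ[MvPolynomial (Fin n) k]
    (ι i →₀ MvPolynomial (Fin n) k)
  /-- the augmentation `F_0 → S/M` -/
  aug : (ι 0 →₀ MvPolynomial (Fin n) k) →ₗ[MvPolynomial (Fin n) k]
    (MvPolynomial (Fin n) k ⧸ M)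
  /-- the entry of the differential matrix at `(c, b)` is a scalar multiple of the monomial
  `mdeg b / mdeg c`, and it is zero if `mdeg c` does not divide `mdeg b` -/
  d_homogeneous : ∀ i (b : ι (i + 1)) (c : ι i),
    ∀ u ∈ (d i (Finsupp.single b 1) c).support, u + mdeg i c = mdeg (i + 1) b
  /-- the augmentation sends `b` to the class of a scalar multiple of the monomial `mdeg b` -/
  aug_homogeneous : ∀ b : ι 0, ∃ r : k,
    aug (Finsupp.single b 1) = Ideal.Quotient.mk M (monomial (mdeg 0 b) r)
  aug_surjective : Function.Surjective aug
  exact_zero : Function.Exact (d 0) aug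
  exact_succ : ∀ i, Function.Exact (d (i + 1)) (d i)

/-- A resolution is minimal if no entry of its differential matrices is invertible. -/
def MultigradedFreeResolution.IsMinimal {k : Type*} [Field k] {n : ℕ}
    {M : Ideal (MvPolynomial (Fin n) k)} (F : MultigradedFreeResolution M) : Prop :=
  ∀ i (b : F.ι (i + 1)) (c : F.ι i), ¬ IsUnit (F.d i (Finsupp.single b 1) c)

/-- The number of basis elements of `F_i` of multidegree `l`. If `F` is minimal, this is the
multigraded Betti number of `S/M` in homological degree `i` and multidegree `l`. -/
def MultigradedFreeResolution.betti {k : Type*} [Field k] {n : ℕ}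
    {M : Ideal (MvPolynomial (Fin n) k)} (F : MultigradedFreeResolution M)
    (i : ℕ) (l : Fin n →₀ ℕ) : ℕ :=
  {b : F.ι i | F.mdeg i b = l}.ncard

open Classical in
/-- `M` has characteristic Betti numbers: `S/M` has a minimal multigraded free resolution and, for
the Betti numbers read off from any such resolution and for every monomial `l`, the sum over all
homological degrees of the Betti numbers in multidegree `l` is `1` if the number of elements of
multidegree `l` in the Taylor basis is odd, and `0` otherwise. (`HasSum` in the discrete space `ℕ`
says that only finitely many terms are nonzero and that they add up to the given value.) -/
def HasCharacteristicBettiNumbers {k : Type*} [Field k] {n : ℕ}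
    (M : Ideal (MvPolynomial (Fin n) k)) : Prop :=
  (∃ F : MultigradedFreeResolution M, F.IsMinimal) ∧
    ∀ F : MultigradedFreeResolution M, F.IsMinimal → ∀ l : Fin n →₀ ℕ,
      HasSum (fun i => F.betti i l) (if Odd (taylorCount M l) then 1 else 0)

end

open MvPolynomial

noncomputable section

universe u v

/-! Setting all variables to 1 turns a multigraded free resolution of $S/M$ into a complex of vector
spaces with a basis, filtered by multidegree. Homogeneity lets the resolution be recovered from the
scalars, and exactness becomes exactness of each filtered piece. This is `StrandResolution`;
`toStrands` and `toMultigraded` translate both ways.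

Any two such complexes are homotopy equivalent by maps that respect the filtration
(`exists_chainMap`, `exists_homotopy`). Passing to the graded piece at a fixed multidegree $l$, the
differential of a minimal resolution vanishes, so its piece is the homology $H$ of the piece $W$ of
the Taylor complex spanned by the sets $T$ with $\operatorname{lcm}(T)=l$
(`Minimal.exists_retraction`). If $D$ is the differential of $W$, then $\dim W=\dim
H+2\operatorname{rank}D$ (`finrank_eq_of_retraction`). The total Betti number at $l$ therefore
always has the parity of the Taylor count, and it remains to show $\dim H\le 1$.

This is where almost genericity enters. A generator dividing $l$ that attains the exponent of $l$ in
a variable of $l$ other than $x_i$ is the only one to do so, hence lies in every $T$ with lcm $l$.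
The other divisors of $l$ matter at most for $x_i$, so adding or removing a suitable one of them
preserves the lcm, apart from at most one set (`exists_toggle`). Signed insertion of that generator
is then a contracting homotopy of $W$ up to an error of rank at most one
(`exists_contraction_error`), whence $\dim H\le 1$ (`Minimal.card_fiber`).

A minimal resolution exists because the Taylor complex is finite and each nonzero constant entry of
its differential can be removed by cancelling two basis elements (`exists_minimal`). -/

/-- The span of the basis elements of homological degree `i` whose multidegree divides `a`. -/
def strand (k : Type u) [Field k] {P : Type v} [PartialOrder P] {ι : Type} (deg : ι → ℕ)
    (mdeg : ι → P) (i : ℕ) (a : P) : Submodule k (ι →₀ k) :=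
  Finsupp.supported k k {b | deg b = i ∧ mdeg b ≤ a}

/-! ### Strands: the filtration by multidegree. -/

section Strand

variable {k : Type u} [Field k] {P : Type v} [PartialOrder P] {ι : Type} {deg : ι → ℕ}
  {mdeg : ι → P} {i : ℕ} {a : P}

theorem mem_strand {x : ι →₀ k} :
    x ∈ strand k deg mdeg i a ↔ ∀ b, x b ≠ 0 → deg b = i ∧ mdeg b ≤ a := by
  simp [strand, Finsupp.mem_supported, Set.subset_def]

theorem strand_le {N : Submodule k (ι →₀ k)}
    (h : ∀ b, deg b = i → mdeg b ≤ a → Finsupp.single b 1 ∈ N) :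
    strand k deg mdeg i a ≤ N := by
  rw [strand, Finsupp.supported_eq_span_single, Submodule.span_le]
  rintro _ ⟨b, ⟨hb, hb'⟩, rfl⟩
  exact h b hb hb'

theorem strand_mono {a' : P} (h : a ≤ a') : strand k deg mdeg i a ≤ strand k deg mdeg i a' :=
  Finsupp.supported_mono fun _ hb => ⟨hb.1, hb.2.trans h⟩

theorem single_mem_strand {b : ι} (hb : deg b = i) (hb' : mdeg b ≤ a) (r : k) :
    Finsupp.single b r ∈ strand k deg mdeg i a :=
  Finsupp.single_mem_supported k r ⟨hb, hb'⟩

theorem eq_on_strand {V : Type*} [AddCommGroup V] [Module k V] {f g : (ι →₀ k) →ₗ[k] V}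
    (h : ∀ b, deg b = i → mdeg b ≤ a → f (Finsupp.single b 1) = g (Finsupp.single b 1))
    {x : ι →₀ k} (hx : x ∈ strand k deg mdeg i a) : f x = g x :=
  strand_le (N := LinearMap.eqLocus f g) h hx

theorem map_mem_strand {ι' : Type} {deg' : ι' → ℕ} {mdeg' : ι' → P} {j : ℕ}
    {f : (ι →₀ k) →ₗ[k] (ι' →₀ k)}
    (h : ∀ b, deg b = i → f (Finsupp.single b 1) ∈ strand k deg' mdeg' j (mdeg b))
    {x : ι →₀ k} (hx : x ∈ strand k deg mdeg i a) : f x ∈ strand k deg' mdeg' j a :=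
  strand_le (N := (strand k deg' mdeg' j a).comap f)
    (fun b hb hb' => strand_mono hb' (h b hb)) hx

theorem hom_ext_single {V : Type*} [AddCommGroup V] [Module k V] {f g : (ι →₀ k) →ₗ[k] V}
    (h : ∀ b, f (Finsupp.single b 1) = g (Finsupp.single b 1)) (x : ι →₀ k) : f x = g x := by
  have : f = g := by
    ext b
    simpa using h b
  rw [this]

theorem eq_zero_of_single {V : Type*} [AddCommGroup V] [Module k V] {f : (ι →₀ k) →ₗ[k] V}
    (h : ∀ b, f (Finsupp.single b 1) = 0) (x : ι →₀ k) : f x = 0 :=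
  (hom_ext_single (g := 0) h x).trans (LinearMap.zero_apply x)

end Strand

/-! ### Restriction to and extension from a part of the basis. -/

section Restrict

variable (k : Type u) [Field k] {ι : Type} (p : ι → Prop)

/-- Restriction of a finitely supported function to the subtype of `p`. -/
def restrictTo : (ι →₀ k) →ₗ[k] ({b // p b} →₀ k) :=
  Finsupp.lsubtypeDomain {b | p b}

/-- Extension by zero of a finitely supported function on the subtype of `p`. -/
def extendByZero : ({b // p b} →₀ k) →ₗ[k] (ι →₀ k) :=
  Finsupp.lmapDomain k k Subtype.val

variable {k p}

theorem restrictTo_apply (x : ι →₀ k) (b : {b // p b}) : restrictTo k p x b = x b.1 :=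
  rfl

theorem restrictTo_single {b : ι} (hb : p b) (r : k) :
    restrictTo k p (Finsupp.single b r) = Finsupp.single ⟨b, hb⟩ r := by
  classical
  ext c
  simp only [restrictTo_apply, Finsupp.single_apply, Subtype.ext_iff]

theorem restrictTo_single_of_not {b : ι} (hb : ¬ p b) (r : k) :
    restrictTo k p (Finsupp.single b r) = 0 := by
  ext c
  have : b ≠ c.1 := fun h => hb (h ▸ c.2)
  simp only [restrictTo_apply, Finsupp.single_eq_of_ne' this, Finsupp.zero_apply]

theorem extendByZero_single (b : {b // p b}) (r : k) :
    extendByZero k p (Finsupp.single b r) = Finsupp.single b.1 r := by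
  simp [extendByZero, Finsupp.mapDomain_single]

theorem extendByZero_apply (x : {b // p b} →₀ k) (b : {b // p b}) :
    extendByZero k p x b.1 = x b :=
  Finsupp.mapDomain_apply Subtype.val_injective x b

theorem extendByZero_apply_of_not (x : {b // p b} →₀ k) {b : ι} (hb : ¬ p b) :
    extendByZero k p x b = 0 := by
  refine Finsupp.mapDomain_of_notMem_range x b ?_
  rintro ⟨y, rfl⟩
  exact hb y.2

theorem restrictTo_extendByZero (x : {b // p b} →₀ k) :
    restrictTo k p (extendByZero k p x) = x := by
  ext b
  rw [restrictTo_apply, extendByZero_apply]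

end Restrict

/-! ### Dehomogenized resolutions and the comparison theorem. -/

/-- The dehomogenization of a multigraded free resolution of `S/M`, where `U` is the set of
exponents of the monomials in `M`: a complex of vector spaces with a basis carrying homological
degrees and multidegrees, whose part of multidegree at most `a` resolves `k` if `a ∉ U` and `0` if
`a ∈ U`. -/
structure StrandResolution (k : Type u) [Field k] {P : Type v} [PartialOrder P]
    (U : Set P) where
  ι : Type
  deg : ι → ℕ
  mdeg : ι → P
  d : (ι →₀ k) →ₗ[k] (ι →₀ k)
  ε : (ι →₀ k) →ₗ[k] k
  d_single : ∀ b c, d (Finsupp.single b 1) c ≠ 0 → deg c + 1 = deg b ∧ mdeg c ≤ mdeg b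
  d_d : ∀ x, d (d x) = 0
  ε_d : ∀ b, deg b = 1 → mdeg b ∉ U → ε (d (Finsupp.single b 1)) = 0
  ε_surjective : ∀ a, a ∉ U → ∃ x ∈ strand k deg mdeg 0 a, ε x = 1
  exact : ∀ i a, ∀ x ∈ strand k deg mdeg i a, d x = 0 → (i = 0 → a ∉ U → ε x = 0) →
    ∃ y ∈ strand k deg mdeg (i + 1) a, d y = x

/-- Dependent choice with an invariant `Q` and a link `R` between consecutive terms; chain maps and
homotopies are built with it one homological degree at a time. -/
theorem exists_seq_of_step {S : Type*} {Q : ℕ → S → Prop} {R : ℕ → S → S → Prop}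
    (h0 : ∃ s, Q 0 s) (hs : ∀ i s, Q i s → ∃ t, Q (i + 1) t ∧ R i s t) :
    ∃ s : ℕ → S, (∀ i, Q i (s i)) ∧ ∀ i, R i (s i) (s (i + 1)) := by
  obtain ⟨s0, h0⟩ := h0
  choose! g hg hg' using hs
  let s : ℕ → S := fun i => Nat.rec s0 g i
  have hs : ∀ i, Q i (s i) := fun i => by
    induction i with
    | zero => exact h0
    | succ i ih => exact hg i _ ih
  exact ⟨s, hs, fun i => hg' i _ (hs i)⟩

theorem exists_linearMap_single {k : Type u} [Field k] {ι V : Type*} [AddCommGroup V]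
    [Module k V] {Q : ι → V → Prop} (h : ∀ b, ∃ y, Q b y) :
    ∃ f : (ι →₀ k) →ₗ[k] V, ∀ b, Q b (f (Finsupp.single b 1)) := by
  choose v hv using h
  exact ⟨Finsupp.linearCombination k v, fun b => by simpa using hv b⟩

namespace StrandResolution

variable {k : Type u} [Field k] {P : Type v} [PartialOrder P] {U : Set P}

theorem d_single_mem (C : StrandResolution k U) {b : C.ι} {i : ℕ} (hb : C.deg b = i + 1) :
    C.d (Finsupp.single b 1) ∈ strand k C.deg C.mdeg i (C.mdeg b) :=
  mem_strand.2 fun c hc => by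
    obtain ⟨h, h'⟩ := C.d_single b c hc
    exact ⟨by omega, h'⟩

theorem d_mem (C : StrandResolution k U) {i : ℕ} {a : P} {x : C.ι →₀ k}
    (hx : x ∈ strand k C.deg C.mdeg (i + 1) a) : C.d x ∈ strand k C.deg C.mdeg i a :=
  map_mem_strand (fun _ hb => C.d_single_mem hb) hx

theorem d_single_eq_zero (C : StrandResolution k U) {b : C.ι} (hb : C.deg b = 0) :
    C.d (Finsupp.single b 1) = 0 := by
  ext c
  by_contra h
  have := (C.d_single b c h).1
  omega

theorem d_eq_zero (C : StrandResolution k U) {a : P} {x : C.ι →₀ k}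
    (hx : x ∈ strand k C.deg C.mdeg 0 a) : C.d x = 0 :=
  eq_on_strand (g := 0) (fun _ hb _ => C.d_single_eq_zero hb) hx

/-- A map raising homological degrees by `j` and not increasing multidegrees. -/
def Filtered (C C' : StrandResolution k U) (j : ℕ) (f : (C.ι →₀ k) →ₗ[k] (C'.ι →₀ k)) : Prop :=
  ∀ b, f (Finsupp.single b 1) ∈ strand k C'.deg C'.mdeg (C.deg b + j) (C.mdeg b)

/-- Since `U` is an upper set, every basis element in a strand at `a ∉ U` has multidegree outside
`U`, so augmentations need only be compared there. -/
theorem ε_eq_of_single (hU : IsUpperSet U) (C C' : StrandResolution k U)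
    {f : (C.ι →₀ k) →ₗ[k] (C'.ι →₀ k)}
    {g : (C.ι →₀ k) →ₗ[k] k}
    (h : ∀ b, C.deg b = 0 → C.mdeg b ∉ U → C'.ε (f (Finsupp.single b 1)) = g (Finsupp.single b 1))
    {a : P} (ha : a ∉ U) {x : C.ι →₀ k} (hx : x ∈ strand k C.deg C.mdeg 0 a) :
    C'.ε (f x) = g x :=
  eq_on_strand (f := C'.ε ∘ₗ f) (g := g)
    (fun b hb hb' => h b hb fun hb'' => ha (hU hb' hb'')) hx

/-- The linear map that agrees with `s i` on basis elements of homological degree `i`. -/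
def glue {C C' : StrandResolution k U} (s : ℕ → (C.ι →₀ k) →ₗ[k] (C'.ι →₀ k)) :
    (C.ι →₀ k) →ₗ[k] (C'.ι →₀ k) :=
  Finsupp.linearCombination k (fun b => s (C.deg b) (Finsupp.single b 1))

@[simp]
theorem glue_single {C C' : StrandResolution k U} (s : ℕ → (C.ι →₀ k) →ₗ[k] (C'.ι →₀ k))
    (b : C.ι) : glue s (Finsupp.single b 1) = s (C.deg b) (Finsupp.single b 1) := by
  simp [glue]

theorem glue_apply {C C' : StrandResolution k U} (s : ℕ → (C.ι →₀ k) →ₗ[k] (C'.ι →₀ k))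
    {i : ℕ} {a : P} {x : C.ι →₀ k} (hx : x ∈ strand k C.deg C.mdeg i a) :
    glue s x = s i x :=
  eq_on_strand (fun b hb _ => by simp [hb]) hx

/-- The usual lifting argument, with exactness of `C'` applied in the strand at the multidegree of
each basis element; this keeps the lift filtered. Over `U` the strands resolve zero, so no condition
on the augmentation is imposed or needed there. -/
theorem exists_chainMap (hU : IsUpperSet U) (C C' : StrandResolution k U) :
    ∃ φ : (C.ι →₀ k) →ₗ[k] (C'.ι →₀ k), Filtered C C' 0 φ ∧ (∀ x, φ (C.d x) = C'.d (φ x)) ∧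
      ∀ b, C.deg b = 0 → C.mdeg b ∉ U →
        C'.ε (φ (Finsupp.single b 1)) = C.ε (Finsupp.single b 1) := by
  -- The second clause of `Q` is the cycle condition that lets exactness lift the map to the next
  -- degree; the third, needed only in degree 0, supplies the augmentation condition.
  refine Exists.elim (exists_seq_of_step (S := (C.ι →₀ k) →ₗ[k] (C'.ι →₀ k))
    (Q := fun i f => (∀ b, C.deg b = i →
        f (Finsupp.single b 1) ∈ strand k C'.deg C'.mdeg i (C.mdeg b)) ∧
      (∀ b, C.deg b = i + 1 → C'.d (f (C.d (Finsupp.single b 1))) = 0) ∧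
      (i = 0 → ∀ b, C.deg b = 0 → C.mdeg b ∉ U →
        C'.ε (f (Finsupp.single b 1)) = C.ε (Finsupp.single b 1)))
    (R := fun i f g => ∀ b, C.deg b = i + 1 →
      C'.d (g (Finsupp.single b 1)) = f (C.d (Finsupp.single b 1))) ?_ ?_) fun s ⟨hs, hs'⟩ => ?main
  case main =>
    refine ⟨glue s, fun b => ?_, fun x => ?_, fun b hb hb' => ?_⟩
    · simpa using (hs _).1 b rfl
    · refine hom_ext_single (f := glue s ∘ₗ C.d) (g := C'.d ∘ₗ glue s) (fun b => ?_) x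
      rcases hb : C.deg b with _ | i
      · have := (hs 0).1 b hb
        simp [C.d_single_eq_zero hb, hb, C'.d_eq_zero this]
      · rw [LinearMap.comp_apply, glue_apply s (C.d_single_mem hb)]
        simp [hb, hs' i b hb]
    · simpa [hb] using (hs 0).2.2 rfl b hb hb'
  · obtain ⟨f, hf⟩ := exists_linearMap_single (k := k) (ι := C.ι)
      (Q := fun b y => y ∈ strand k C'.deg C'.mdeg 0 (C.mdeg b) ∧
        (C.mdeg b ∉ U → C'.ε y = C.ε (Finsupp.single b 1))) (fun b => by
        by_cases hb : C.mdeg b ∈ U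
        · exact ⟨0, zero_mem _, fun h => absurd hb h⟩
        · obtain ⟨x, hx, hx'⟩ := C'.ε_surjective _ hb
          exact ⟨C.ε (Finsupp.single b 1) • x, Submodule.smul_mem _ _ hx, fun _ => by simp [hx']⟩)
    refine ⟨f, fun b _ => (hf b).1, fun b hb => ?_, fun _ b _ hb => (hf b).2 hb⟩
    exact C'.d_eq_zero (map_mem_strand (fun b _ => (hf b).1) (C.d_single_mem hb))
  · rintro i f ⟨hf, hf', hf''⟩
    obtain ⟨g, hg⟩ := exists_linearMap_single (k := k) (ι := C.ι)
      (Q := fun b y => C.deg b = i + 1 → y ∈ strand k C'.deg C'.mdeg (i + 1) (C.mdeg b) ∧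
        C'.d y = f (C.d (Finsupp.single b 1))) (fun b => by
        by_cases hb : C.deg b = i + 1
        · obtain ⟨y, hy, hy'⟩ := C'.exact i (C.mdeg b) (f (C.d (Finsupp.single b 1)))
            (map_mem_strand hf (C.d_single_mem hb)) (hf' b hb) (by
              rintro rfl ha
              rw [ε_eq_of_single hU C C' (hf'' rfl) ha (C.d_single_mem hb), C.ε_d b hb ha])
          exact ⟨y, fun _ => ⟨hy, hy'⟩⟩
        · exact ⟨0, fun h => absurd h hb⟩)
    refine ⟨g, ⟨fun b hb => (hg b hb).1, fun b hb => ?_, by omega⟩, fun b hb => (hg b hb).2⟩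
    have : (C'.d ∘ₗ g) (C.d (Finsupp.single b 1)) = (f ∘ₗ C.d) (C.d (Finsupp.single b 1)) :=
      eq_on_strand (fun c hc _ => (hg c hc).2) (C.d_single_mem hb)
    simpa [C.d_d] using this

/-- A lift of the zero augmentation is null-homotopic: in each degree `f - h d` is a cycle on basis
elements, and exactness of the strand at their multidegree supplies the next value of the homotopy.
-/
theorem exists_homotopy (C C' : StrandResolution k U)
    {f : (C.ι →₀ k) →ₗ[k] (C'.ι →₀ k)} (hf : Filtered C C' 0 f)
    (hd : ∀ x, f (C.d x) = C'.d (f x))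
    (hε : ∀ b, C.deg b = 0 → C.mdeg b ∉ U → C'.ε (f (Finsupp.single b 1)) = 0) :
    ∃ h : (C.ι →₀ k) →ₗ[k] (C'.ι →₀ k), Filtered C C' 1 h ∧
      ∀ x, f x = C'.d (h x) + h (C.d x) := by
  refine Exists.elim (exists_seq_of_step (S := (C.ι →₀ k) →ₗ[k] (C'.ι →₀ k))
    (Q := fun i h => (∀ b, C.deg b = i →
        h (Finsupp.single b 1) ∈ strand k C'.deg C'.mdeg (i + 1) (C.mdeg b)) ∧
      (∀ b, C.deg b = i + 1 →
        f (C.d (Finsupp.single b 1)) = C'.d (h (C.d (Finsupp.single b 1)))) ∧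
      (i = 0 → ∀ b, C.deg b = 0 → C'.d (h (Finsupp.single b 1)) = f (Finsupp.single b 1)))
    (R := fun i h h' => ∀ b, C.deg b = i + 1 →
      C'.d (h' (Finsupp.single b 1)) = f (Finsupp.single b 1) - h (C.d (Finsupp.single b 1)))
    ?_ ?_) fun s ⟨hs, hs'⟩ => ?main
  case main =>
    refine ⟨glue s, fun b => ?_, fun x => ?_⟩
    · simpa using (hs _).1 b rfl
    · refine hom_ext_single (g := C'.d ∘ₗ glue s + glue s ∘ₗ C.d) (fun b => ?_) x
      rcases hb : C.deg b with _ | i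
      · simp [C.d_single_eq_zero hb, hb, (hs 0).2.2 rfl b hb]
      · rw [LinearMap.add_apply, LinearMap.comp_apply, LinearMap.comp_apply,
          glue_apply s (C.d_single_mem hb)]
        simp [hb, hs' i b hb]
  · obtain ⟨h, hh⟩ := exists_linearMap_single (k := k) (ι := C.ι)
      (Q := fun b y => C.deg b = 0 → y ∈ strand k C'.deg C'.mdeg 1 (C.mdeg b) ∧
        C'.d y = f (Finsupp.single b 1)) (fun b => by
        by_cases hb : C.deg b = 0
        · have hfb : f (Finsupp.single b 1) ∈ strand k C'.deg C'.mdeg 0 (C.mdeg b) := by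
            simpa [hb] using hf b
          obtain ⟨y, hy, hy'⟩ := C'.exact 0 (C.mdeg b) _ hfb (C'.d_eq_zero hfb)
            (fun _ ha => hε b hb ha)
          exact ⟨y, fun _ => ⟨hy, hy'⟩⟩
        · exact ⟨0, fun h => absurd h hb⟩)
    refine ⟨h, fun b hb => (hh b hb).1, fun b hb => ?_, fun _ b hb => (hh b hb).2⟩
    exact eq_on_strand (f := f) (g := C'.d ∘ₗ h) (fun c hc _ => (hh c hc).2.symm)
      (C.d_single_mem hb)
  · rintro i h ⟨hh, hh', -⟩
    obtain ⟨g, hg⟩ := exists_linearMap_single (k := k) (ι := C.ι)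
      (Q := fun b y => C.deg b = i + 1 → y ∈ strand k C'.deg C'.mdeg (i + 2) (C.mdeg b) ∧
        C'.d y = f (Finsupp.single b 1) - h (C.d (Finsupp.single b 1))) (fun b => by
        by_cases hb : C.deg b = i + 1
        · obtain ⟨y, hy, hy'⟩ := C'.exact (i + 1) (C.mdeg b)
            (f (Finsupp.single b 1) - h (C.d (Finsupp.single b 1)))
            (sub_mem (by simpa [hb] using hf b) (map_mem_strand hh (C.d_single_mem hb)))
            (by rw [map_sub, ← hd, hh' b hb, sub_self]) (by omega)
          exact ⟨y, fun _ => ⟨hy, hy'⟩⟩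
        · exact ⟨0, fun h => absurd h hb⟩)
    refine ⟨g, ⟨fun b hb => (hg b hb).1, fun b hb => ?_, by omega⟩, fun b hb => (hg b hb).2⟩
    have : (C'.d ∘ₗ g) (C.d (Finsupp.single b 1)) = (f - h ∘ₗ C.d) (C.d (Finsupp.single b 1)) :=
      eq_on_strand (fun c hc _ => (hg c hc).2) (C.d_single_mem hb)
    simpa [C.d_d] using this.symm

end StrandResolution

/-! ### Graded pieces at a single multidegree. -/

/-- The part of a linear map between basis elements singled out by `p` and `p'`. -/
def fiberMap {k : Type u} [Field k] {ι ι' : Type} (p : ι → Prop) (p' : ι' → Prop)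
    (f : (ι →₀ k) →ₗ[k] (ι' →₀ k)) : ({b // p b} →₀ k) →ₗ[k] ({b // p' b} →₀ k) :=
  restrictTo k p' ∘ₗ f ∘ₗ extendByZero k p

section FiberMap

variable {k : Type u} [Field k] {P : Type v} [PartialOrder P] {ι ι' ι'' : Type}

theorem fiberMap_apply {p : ι → Prop} {p' : ι' → Prop} (f : (ι →₀ k) →ₗ[k] (ι' →₀ k))
    (x : {b // p b} →₀ k) : fiberMap p p' f x = restrictTo k p' (f (extendByZero k p x)) :=
  rfl

theorem fiberMap_add {p : ι → Prop} {p' : ι' → Prop} (f g : (ι →₀ k) →ₗ[k] (ι' →₀ k)) :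
    fiberMap p p' (f + g) = fiberMap p p' f + fiberMap p p' g := by
  simp [fiberMap, LinearMap.add_comp, LinearMap.comp_add]

theorem fiberMap_sub {p : ι → Prop} {p' : ι' → Prop} (f g : (ι →₀ k) →ₗ[k] (ι' →₀ k)) :
    fiberMap p p' (f - g) = fiberMap p p' f - fiberMap p p' g := by
  simp [fiberMap, LinearMap.sub_comp, LinearMap.comp_sub]

theorem fiberMap_id {p : ι → Prop} :
    fiberMap p p (LinearMap.id : (ι →₀ k) →ₗ[k] (ι →₀ k)) = LinearMap.id :=
  LinearMap.ext fun x => restrictTo_extendByZero x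

/-- Passing to the associated graded is functorial for filtered maps: what `f` sends strictly below
`l` cannot be brought back up to `l` by `g`. -/
theorem fiberMap_comp {m : ι → P} {m' : ι' → P} {m'' : ι'' → P} (l : P)
    {f : (ι →₀ k) →ₗ[k] (ι' →₀ k)} {g : (ι' →₀ k) →ₗ[k] (ι'' →₀ k)}
    (hf : ∀ b c, f (Finsupp.single b 1) c ≠ 0 → m' c ≤ m b)
    (hg : ∀ b c, g (Finsupp.single b 1) c ≠ 0 → m'' c ≤ m' b) :
    fiberMap (fun b => m b = l) (fun b => m'' b = l) (g ∘ₗ f) =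
      fiberMap (fun b => m' b = l) (fun b => m'' b = l) g ∘ₗ
        fiberMap (fun b => m b = l) (fun b => m' b = l) f := by
  have key : Finsupp.supported k k {c | m' c ≤ l} ≤
      LinearMap.eqLocus (restrictTo k (fun c => m'' c = l) ∘ₗ g)
        (fiberMap (fun b => m' b = l) (fun b => m'' b = l) g ∘ₗ
          restrictTo k (fun c => m' c = l)) := by
    rw [Finsupp.supported_eq_span_single, Submodule.span_le]
    rintro _ ⟨c, hc, rfl⟩
    change restrictTo k _ (g _) = fiberMap _ _ g (restrictTo k _ _)
    by_cases hcl : m' c = l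
    · rw [restrictTo_single hcl, fiberMap_apply, extendByZero_single]
    · rw [restrictTo_single_of_not hcl, map_zero]
      ext e
      rw [restrictTo_apply, Finsupp.zero_apply]
      by_contra hne
      exact hcl (le_antisymm hc (e.2 ▸ hg c e.1 hne))
  refine Finsupp.lhom_ext' fun b => LinearMap.ext_ring ?_
  have := key (x := f (Finsupp.single b.1 1)) ((Finsupp.mem_supported _ _).2 fun c hc => by
    have := hf b.1 c (by simpa using hc)
    rwa [b.2] at this)
  rw [← extendByZero_single] at this
  exact this

end FiberMap

/-! ### Cancellation of basis elements and existence of minimal resolutions. -/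

namespace StrandResolution

variable {k : Type u} [Field k] {P : Type v} [PartialOrder P] {U : Set P}

theorem mdeg_le_of_d (C : StrandResolution k U) {i : ℕ} {a : P} {x : C.ι →₀ k}
    (hx : x ∈ strand k C.deg C.mdeg i a) {c : C.ι} (hc : C.d x c ≠ 0) :
    C.deg c + 1 = i ∧ C.mdeg c ≤ a := by
  rcases i with _ | i
  · simp [C.d_eq_zero hx] at hc
  · obtain ⟨h, h'⟩ := mem_strand.1 (C.d_mem hx) c hc
    exact ⟨by omega, h'⟩

section Cancel

variable (C : StrandResolution k U) (b₀ c₀ : C.ι)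

/-- The basis left after cancelling `b₀` against `c₀`. -/
abbrev CancelIndex : Type := {x : C.ι // x ≠ b₀ ∧ x ≠ c₀}

/-- The inclusion of the remaining basis elements. -/
def cancelIncl : (C.CancelIndex b₀ c₀ →₀ k) →ₗ[k] (C.ι →₀ k) :=
  extendByZero k _

/-- The projection with kernel spanned by `b₀` and `d b₀`. -/
def cancelProj : (C.ι →₀ k) →ₗ[k] (C.CancelIndex b₀ c₀ →₀ k) :=
  restrictTo k _ ∘ₗ
    (LinearMap.id - ((C.d (Finsupp.single b₀ 1) c₀)⁻¹ • Finsupp.lapply c₀).smulRight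
      (C.d (Finsupp.single b₀ 1)))

variable {C b₀ c₀}

theorem cancelIncl_single (b : C.CancelIndex b₀ c₀) (r : k) :
    C.cancelIncl b₀ c₀ (Finsupp.single b r) = Finsupp.single b.1 r :=
  extendByZero_single b r

theorem cancelIncl_apply_val (x : C.CancelIndex b₀ c₀ →₀ k) (b : C.CancelIndex b₀ c₀) :
    C.cancelIncl b₀ c₀ x b.1 = x b :=
  extendByZero_apply x b

theorem cancelIncl_apply_of_eq (x : C.CancelIndex b₀ c₀ →₀ k) {b : C.ι} (hb : b = b₀ ∨ b = c₀) :
    C.cancelIncl b₀ c₀ x b = 0 :=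
  extendByZero_apply_of_not x fun h => hb.elim h.1 h.2

theorem cancelProj_apply (x : C.ι →₀ k) (b : C.CancelIndex b₀ c₀) :
    C.cancelProj b₀ c₀ x b =
      x b.1 - (C.d (Finsupp.single b₀ 1) c₀)⁻¹ * x c₀ * C.d (Finsupp.single b₀ 1) b.1 := by
  simp [cancelProj, restrictTo_apply]

theorem cancelProj_incl (x : C.CancelIndex b₀ c₀ →₀ k) :
    C.cancelProj b₀ c₀ (C.cancelIncl b₀ c₀ x) = x := by
  ext b
  rw [cancelProj_apply, cancelIncl_apply_val, cancelIncl_apply_of_eq x (Or.inr rfl)]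
  ring

theorem d_apply_self (b : C.ι) : C.d (Finsupp.single b 1) b = 0 := by
  by_contra h
  have := (C.d_single b b h).1
  omega

variable (h : C.d (Finsupp.single b₀ 1) c₀ ≠ 0)

include h

theorem cancelIncl_proj (x : C.ι →₀ k) :
    C.cancelIncl b₀ c₀ (C.cancelProj b₀ c₀ x) =
      x - ((C.d (Finsupp.single b₀ 1) c₀)⁻¹ * x c₀) • C.d (Finsupp.single b₀ 1) -
        Finsupp.single b₀ (x b₀) := by
  classical
  ext b
  by_cases hb : b = b₀
  · subst hb
    rw [cancelIncl_apply_of_eq _ (Or.inl rfl)]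
    simp [d_apply_self]
  by_cases hb' : b = c₀
  · subst hb'
    rw [cancelIncl_apply_of_eq _ (Or.inr rfl)]
    simp [Ne.symm hb]
    field_simp
    simp
  · rw [show b = (⟨b, hb, hb'⟩ : C.CancelIndex b₀ c₀).1 from rfl, cancelIncl_apply_val,
      cancelProj_apply]
    simp [Ne.symm hb]

theorem cancelProj_d_single : C.cancelProj b₀ c₀ (C.d (Finsupp.single b₀ 1)) = 0 := by
  ext b
  rw [cancelProj_apply]
  field_simp
  simp

theorem cancelProj_single (r : k) : C.cancelProj b₀ c₀ (Finsupp.single b₀ r) = 0 := by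
  have hne : b₀ ≠ c₀ := by
    rintro rfl
    exact h (d_apply_self b₀)
  ext b
  rw [cancelProj_apply]
  simp [b.2.1, hne]

/-- Including after projecting changes `x` only by multiples of `b₀` and `d b₀`. The differential
sends these to multiples of `d b₀` and to zero, which the projection kills. -/
theorem cancelProj_d (x : C.ι →₀ k) :
    C.cancelProj b₀ c₀ (C.d (C.cancelIncl b₀ c₀ (C.cancelProj b₀ c₀ x))) =
      C.cancelProj b₀ c₀ (C.d x) := by
  have : Finsupp.single b₀ (x b₀) = x b₀ • Finsupp.single b₀ (1 : k) := by simp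
  rw [cancelIncl_proj h, this]
  simp only [map_sub, map_smul, C.d_d, cancelProj_d_single h, smul_zero, sub_zero]

variable (hm : C.mdeg c₀ = C.mdeg b₀)

include hm

theorem cancelProj_mem {i : ℕ} {a : P} {x : C.ι →₀ k} (hx : x ∈ strand k C.deg C.mdeg i a) :
    C.cancelProj b₀ c₀ x ∈
      strand k (fun b : C.CancelIndex b₀ c₀ => C.deg b.1) (fun b => C.mdeg b.1) i a := by
  refine mem_strand.2 fun b hb => ?_
  rw [mem_strand] at hx
  by_cases hxb : x b.1 = 0
  · rw [cancelProj_apply, hxb] at hb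
    have hc : x c₀ ≠ 0 := by
      intro h0
      simp [h0] at hb
    have hd : C.d (Finsupp.single b₀ 1) b.1 ≠ 0 := by
      intro h0
      simp [h0] at hb
    have h1 := C.d_single _ _ h
    have h2 := C.d_single _ _ hd
    have h3 := hx _ hc
    exact ⟨by omega, h2.2.trans (hm ▸ h3.2)⟩
  · exact hx _ hxb

theorem ε_cancel {a : P} (hU : IsUpperSet U) (ha : a ∉ U) {x : C.ι →₀ k}
    (hx : x ∈ strand k C.deg C.mdeg 0 a) :
    C.ε (C.cancelIncl b₀ c₀ (C.cancelProj b₀ c₀ x)) = C.ε x := by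
  rw [mem_strand] at hx
  have h1 := C.d_single _ _ h
  have hb : x b₀ = 0 := by
    by_contra h0
    have := hx _ h0
    omega
  rw [cancelIncl_proj h, hb]
  by_cases hc : x c₀ = 0
  · simp [hc]
  · have h3 := hx _ hc
    have h4 : C.mdeg b₀ ∉ U := fun h' => ha (hU (hm ▸ h3.2) h')
    simp [C.ε_d b₀ (by omega) h4]

/-- The resolution obtained by cancelling `b₀` against `c₀`. -/
def cancel (hU : IsUpperSet U) : StrandResolution k U where
  ι := C.CancelIndex b₀ c₀
  deg b := C.deg b.1
  mdeg b := C.mdeg b.1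
  d := C.cancelProj b₀ c₀ ∘ₗ C.d ∘ₗ C.cancelIncl b₀ c₀
  ε := C.ε ∘ₗ C.cancelIncl b₀ c₀
  d_single b c hc := by
    rw [LinearMap.comp_apply, LinearMap.comp_apply, cancelIncl_single] at hc
    rcases hb : C.deg b.1 with _ | i
    · simp [C.d_single_eq_zero hb] at hc
    · have := mem_strand.1 (cancelProj_mem h hm (C.d_single_mem hb)) c hc
      exact ⟨by omega, this.2⟩
  d_d x := by
    simp only [LinearMap.comp_apply]
    rw [cancelProj_d h, C.d_d, map_zero]
  ε_d b hb hb' := by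
    simp only [LinearMap.comp_apply, cancelIncl_single]
    rw [ε_cancel h hm hU hb' (C.d_single_mem hb), C.ε_d _ hb hb']
  ε_surjective a ha := by
    obtain ⟨x, hx, hx'⟩ := C.ε_surjective a ha
    exact ⟨_, cancelProj_mem h hm hx, by rw [LinearMap.comp_apply, ε_cancel h hm hU ha hx, hx']⟩
  exact i a x' hx' hd hε := by
    simp only [LinearMap.comp_apply] at hd hε
    set x := C.cancelIncl b₀ c₀ x' with hxdef
    have hx : x ∈ strand k C.deg C.mdeg i a :=
      strand_le (N := (strand k C.deg C.mdeg i a).comap (C.cancelIncl b₀ c₀))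
        (fun b hb hb' => by
          simpa [Submodule.mem_comap, cancelIncl_single] using single_mem_strand hb hb' 1) hx'
    have h0 := cancelIncl_proj h (C.d x)
    rw [hd, map_zero] at h0
    set β := (C.d (Finsupp.single b₀ 1) c₀)⁻¹ * C.d x c₀ with hβ
    -- Applying `d` to `h0` leaves a multiple of `d b₀`, whose coefficient at `c₀` is nonzero.
    have hγ : C.d x b₀ = 0 := by
      have h1 := congrArg C.d h0
      have h2 : Finsupp.single b₀ (C.d x b₀) = C.d x b₀ • Finsupp.single b₀ (1 : k) := by simp
      rw [h2] at h1
      simp only [map_zero, map_sub, map_smul, C.d_d, smul_zero, sub_zero, zero_sub] at h1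
      have h3 := congrArg (fun f => f c₀) h1
      simpa [h] using h3
    rw [hγ, Finsupp.single_zero, sub_zero] at h0
    have hb₀ := C.d_single _ _ h
    have hβx : β • Finsupp.single b₀ 1 ∈ strand k C.deg C.mdeg i a := by
      by_cases hc : C.d x c₀ = 0
      · simp [hβ, hc]
      · have := C.mdeg_le_of_d hx hc
        exact Submodule.smul_mem _ _ (single_mem_strand (by omega) (hm ▸ this.2) 1)
    have hβ0 : i = 0 → β = 0 := by
      rintro rfl
      rw [hβ, C.d_eq_zero hx]
      simp
    -- Now `d x = β d b₀`, so subtracting `β b₀` makes `x` a cycle of the original complex; the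
    -- projection later removes the correction.
    obtain ⟨y, hy, hy'⟩ := C.exact i a (x - β • Finsupp.single b₀ 1) (sub_mem hx hβx)
      (by rw [map_sub, map_smul, ← h0]) (by
        intro hi ha
        rw [hβ0 hi, zero_smul, sub_zero]
        exact hε hi ha)
    refine ⟨C.cancelProj b₀ c₀ y, cancelProj_mem h hm hy, ?_⟩
    simp only [LinearMap.comp_apply]
    rw [cancelProj_d h, hy', map_sub, map_smul, cancelProj_single h, smul_zero, sub_zero,
      hxdef, cancelProj_incl]

end Cancel

/-- No entry of the differential is a nonzero constant. -/
def Minimal (C : StrandResolution k U) : Prop :=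
  ∀ b c, C.mdeg c = C.mdeg b → C.d (Finsupp.single b 1) c = 0

/-- A nonzero entry between equal multidegrees can be cancelled, which strictly decreases the number
of basis elements. -/
theorem exists_minimal (hU : IsUpperSet U) (C : StrandResolution k U) [Finite C.ι] :
    ∃ C' : StrandResolution k U, Finite C'.ι ∧ C'.Minimal := by
  induction hN : Nat.card C.ι using Nat.strong_induction_on generalizing C with
  | _ N ih =>
  by_cases hC : C.Minimal
  · exact ⟨C, ‹_›, hC⟩
  · simp only [Minimal, not_forall] at hC
    obtain ⟨b, c, hm, h⟩ := hC
    have : Finite (cancel h hm hU).ι := inferInstanceAs (Finite (C.CancelIndex b c))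
    refine ih _ ?_ (cancel h hm hU) rfl
    rw [← hN]
    exact Finite.card_subtype_lt (p := fun x => x ≠ b ∧ x ≠ c) (x := b) (by simp)

end StrandResolution

/-! ### The simplex boundary, the Taylor complex and contraction up to rank one. -/

section Simplex

variable (k : Type u) [Field k] {V : Type} [LinearOrder V]

/-- The sign of the vertex `t` in the face `T`. -/
def vertexSign (t : V) (T : Finset V) : k := (-1) ^ (T.filter (· < t)).card

/-- The boundary map of the full simplex on `V`. -/
def simplexBoundary : (Finset V →₀ k) →ₗ[k] (Finset V →₀ k) :=
  Finsupp.linearCombination k fun T =>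
    ∑ t ∈ T, vertexSign k t T • Finsupp.single (T.erase t) (1 : k)

/-- Insertion of the vertex `g`, with sign. -/
def simplexInsert (g : V) : (Finset V →₀ k) →ₗ[k] (Finset V →₀ k) :=
  Finsupp.linearCombination k fun T =>
    if g ∈ T then 0 else vertexSign k g T • Finsupp.single (insert g T) (1 : k)

variable {k}

theorem simplexBoundary_single (T : Finset V) :
    simplexBoundary k (Finsupp.single T 1) =
      ∑ t ∈ T, vertexSign k t T • Finsupp.single (T.erase t) (1 : k) := by
  simp [simplexBoundary]

theorem simplexInsert_single (g : V) (T : Finset V) :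
    simplexInsert k g (Finsupp.single T 1) =
      if g ∈ T then 0 else vertexSign k g T • Finsupp.single (insert g T) (1 : k) := by
  simp [simplexInsert]

theorem vertexSign_mul_self (t : V) (T : Finset V) :
    vertexSign k t T * vertexSign k t T = 1 := by
  rw [vertexSign, ← pow_add, ← two_mul, pow_mul]
  simp

theorem vertexSign_erase_self (t : V) (T : Finset V) :
    vertexSign k t (T.erase t) = vertexSign k t T := by
  rw [vertexSign, vertexSign, Finset.filter_erase, Finset.erase_eq_of_notMem (by simp)]

theorem vertexSign_erase_of_lt {t u : V} (T : Finset V) (h : t < u) :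
    vertexSign k t (T.erase u) = vertexSign k t T := by
  rw [vertexSign, vertexSign, Finset.filter_erase,
    Finset.erase_eq_of_notMem (by simp [h.le])]

theorem vertexSign_erase_of_gt {t u : V} {T : Finset V} (h : t < u) (ht : t ∈ T) :
    vertexSign k u (T.erase t) = -vertexSign k u T := by
  have : t ∈ T.filter (· < u) := by simp [h, ht]
  rw [vertexSign, vertexSign, Finset.filter_erase, ← Finset.card_erase_add_one this, pow_succ]
  simp

theorem vertexSign_swap {t u : V} {T : Finset V} (h : t ≠ u) (ht : t ∈ T) (hu : u ∈ T) :
    vertexSign k t T * vertexSign k u (T.erase t) +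
      vertexSign k u T * vertexSign k t (T.erase u) = 0 := by
  rcases lt_or_gt_of_ne h with h | h
  · rw [vertexSign_erase_of_gt h ht, vertexSign_erase_of_lt T h]
    ring
  · rw [vertexSign_erase_of_gt h hu, vertexSign_erase_of_lt T h]
    ring

theorem simplexBoundary_simplexBoundary (x : Finset V →₀ k) :
    simplexBoundary k (simplexBoundary k x) = 0 := by
  rw [← LinearMap.comp_apply]
  refine eq_zero_of_single (fun T => ?_) x
  simp only [LinearMap.comp_apply, simplexBoundary_single, map_sum, map_smul, Finset.smul_sum]
  rw [Finset.sum_sigma']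
  -- Deleting the same two vertices in the opposite order gives the same face with opposite sign.
  refine Finset.sum_involution (fun p _ => ⟨p.2, p.1⟩) ?_ ?_ ?_ ?_
  · rintro ⟨t, u⟩ h
    simp only [Finset.mem_sigma, Finset.mem_erase] at h
    rw [Finset.erase_right_comm, smul_smul, smul_smul, ← add_smul,
      vertexSign_swap (Ne.symm h.2.1) h.1 h.2.2, zero_smul]
  · rintro ⟨t, u⟩ h _ heq
    simp only [Finset.mem_sigma, Finset.mem_erase] at h
    exact h.2.1 (congrArg Sigma.fst heq)
  · rintro ⟨t, u⟩ h
    simp only [Finset.mem_sigma, Finset.mem_erase] at h ⊢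
    exact ⟨h.2.2, Ne.symm h.2.1, h.1⟩
  · intro p _
    rfl

/-- The full simplex is a cone with apex `g`. On a face containing `g` only the deletion of `g`
survives; on any other face the remaining terms cancel in pairs. -/
theorem simplex_contraction (g : V) (x : Finset V →₀ k) :
    simplexBoundary k (simplexInsert k g x) + simplexInsert k g (simplexBoundary k x) = x := by
  refine hom_ext_single (f := simplexBoundary k ∘ₗ simplexInsert k g +
    simplexInsert k g ∘ₗ simplexBoundary k) (g := LinearMap.id) (fun T => ?_) x
  simp only [LinearMap.add_apply, LinearMap.comp_apply, LinearMap.id_apply]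
  rw [simplexInsert_single, simplexBoundary_single, map_sum]
  simp only [map_smul, simplexInsert_single]
  by_cases hg : g ∈ T
  · rw [if_pos hg, map_zero, zero_add, Finset.sum_eq_single g]
    · rw [if_neg (by simp), Finset.insert_erase hg, vertexSign_erase_self, smul_smul,
        vertexSign_mul_self, one_smul]
    · intro t _ htg
      rw [if_pos (by simp [hg, htg.symm]), smul_zero]
    · exact fun h => absurd hg h
  · rw [if_neg hg, map_smul, simplexBoundary_single, Finset.sum_insert hg, smul_add,
      Finset.erase_insert hg, smul_smul, Finset.smul_sum]
    have h1 : vertexSign k g (insert g T) = vertexSign k g T := by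
      rw [← vertexSign_erase_self g (insert g T), Finset.erase_insert hg]
    rw [h1, vertexSign_mul_self, one_smul, add_assoc, ← Finset.sum_add_distrib,
      Finset.sum_eq_zero, add_zero]
    intro t ht
    have htg : t ≠ g := fun h => hg (h ▸ ht)
    have h2 := vertexSign_swap (k := k) htg (Finset.mem_insert_of_mem ht)
      (Finset.mem_insert_self g T)
    have h3 : (insert g T).erase t = insert g (T.erase t) :=
      Finset.erase_insert_of_ne htg.symm
    have h4 : vertexSign k g ((insert g T).erase t) = vertexSign k g (T.erase t) := by
      rw [h3, ← vertexSign_erase_self g (insert g (T.erase t)), Finset.erase_insert (by simp [hg])]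
    rw [h4, h1, Finset.erase_insert hg] at h2
    rw [if_neg (by simp [hg]), smul_smul, smul_smul, h3, ← add_smul]
    suffices h : vertexSign k g T * vertexSign k t (insert g T) +
        vertexSign k t T * vertexSign k g (T.erase t) = 0 by rw [h, zero_smul]
    -- Exactly one of the two signs flips, according to which of `t` and `g` comes first.
    rcases lt_or_gt_of_ne htg with h | h
    · have h5 := vertexSign_erase_of_lt (k := k) (insert g T) h
      have h6 := vertexSign_erase_of_gt (k := k) h ht
      rw [Finset.erase_insert hg] at h5
      rw [h6, ← h5]
      ring
    · have h5 := vertexSign_erase_of_gt (k := k) h (Finset.mem_insert_self g T)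
      have h6 := vertexSign_erase_of_lt (k := k) T h
      rw [Finset.erase_insert hg] at h5
      rw [h6, h5]
      ring

theorem simplexBoundary_single_ne {T T' : Finset V}
    (h : simplexBoundary k (Finsupp.single T 1) T' ≠ 0) : ∃ t ∈ T, T' = T.erase t := by
  rw [simplexBoundary_single, Finsupp.finsetSum_apply] at h
  obtain ⟨t, ht, h⟩ := Finset.exists_ne_zero_of_sum_ne_zero h
  refine ⟨t, ht, ?_⟩
  by_contra hne
  simp [Ne.symm hne] at h

theorem simplexInsert_single_ne {g : V} {T T' : Finset V}
    (h : simplexInsert k g (Finsupp.single T 1) T' ≠ 0) : g ∉ T ∧ T' = insert g T := by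
  rw [simplexInsert_single] at h
  split_ifs at h with hg
  · simp at h
  · refine ⟨hg, ?_⟩
    by_contra hne
    simp [Ne.symm hne] at h

variable {P : Type v} [SemilatticeSup P] [OrderBot P]

/-- The Taylor complex of the monomials `g v`. -/
def taylorResolution (k : Type u) [Field k] (g : V → P) (U : Set P) (hg : ∀ v, g v ∈ U)
    (hU : IsUpperSet U) (hU' : ∀ a ∈ U, ∃ v, g v ≤ a) : StrandResolution k U where
  ι := Finset V
  deg := Finset.card
  mdeg T := T.sup g
  d := simplexBoundary k
  ε := Finsupp.lapply ∅
  d_single T T' h := by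
    obtain ⟨t, ht, rfl⟩ := simplexBoundary_single_ne h
    exact ⟨Finset.card_erase_add_one ht, Finset.sup_mono (Finset.erase_subset t T)⟩
  d_d := simplexBoundary_simplexBoundary
  ε_d T hT hTU := by
    -- The condition is vacuous: a face with one vertex has the multidegree of a generator, which
    -- lies in `U`.
    obtain ⟨v, rfl⟩ := Finset.card_eq_one.1 hT
    exact absurd (by simpa using hg v) hTU
  ε_surjective a _ :=
    ⟨Finsupp.single ∅ 1, single_mem_strand Finset.card_empty (by simp) 1, by simp⟩
  exact i a x hx hd hε := by
    by_cases ha : a ∈ U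
    -- The faces of multidegree at most `a` form the full simplex on the generators below `a`; over
    -- `U` there is at least one, and it serves as cone point.
    · obtain ⟨v, hv⟩ := hU' a ha
      have hc := simplex_contraction v x
      rw [hd, map_zero, add_zero] at hc
      refine ⟨_, ?_, hc⟩
      refine strand_le (N := (strand k Finset.card (fun T : Finset V => T.sup g) (i + 1) a).comap
        (simplexInsert k v)) (fun T hT hTa => mem_strand.2 fun T' hT' => ?_) hx
      obtain ⟨hvT, rfl⟩ := simplexInsert_single_ne hT'
      exact ⟨by rw [Finset.card_insert_of_notMem hvT, hT],
        by rw [Finset.sup_insert]; exact sup_le hv hTa⟩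
    -- Outside `U` no generator lies below `a`, so the strand contains at most the empty face, whose
    -- coefficient is the augmentation.
    · refine ⟨0, zero_mem _, ?_⟩
      rw [map_zero]
      ext T
      by_contra hne
      obtain ⟨hT, hTa⟩ := mem_strand.1 hx T (Ne.symm hne)
      have hT0 : T = ∅ := by
        rw [Finset.eq_empty_iff_forall_notMem]
        exact fun v hv => ha (hU ((Finset.le_sup hv).trans hTa) (hg v))
      subst hT0
      exact hne (hε hT.symm ha).symm

/-- If toggling `g` preserves the class `p` of faces up to one exception, then `simplexInsert k g`
contracts the boundary map on `p` up to an error of rank at most one. -/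
theorem exists_contraction_error (p : Finset V → Prop)
    (hp : (∃ T₀, ∀ T, p T → T = T₀) ∨ ∃ g T₀, ∀ T, p T → T ≠ T₀ →
      if g ∈ T then p (T.erase g) else p (insert g T)) :
    ∃ (I : ({T // p T} →₀ k) →ₗ[k] ({T // p T} →₀ k)) (v : {T // p T} →₀ k), ∀ x,
      ∃ r : k, x = fiberMap p p (simplexBoundary k) (I x) +
        I (fiberMap p p (simplexBoundary k) x) + r • v := by
  classical
  rcases hp with ⟨T₀, hp⟩ | ⟨g, T₀, hp⟩
  · by_cases h : p T₀
    · refine ⟨0, Finsupp.single ⟨T₀, h⟩ 1, fun x => ⟨x ⟨T₀, h⟩, ?_⟩⟩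
      ext ⟨T, hT⟩
      obtain rfl := hp T hT
      simp
    · refine ⟨0, 0, fun x => ⟨0, ?_⟩⟩
      ext ⟨T, hT⟩
      exact absurd (hp T hT ▸ hT) h
  set D := simplexBoundary k (V := V)
  set I := simplexInsert k g
  let q : (Finset V →₀ k) →ₗ[k] ({T // p T} →₀ k) := restrictTo k p
  let j : ({T // p T} →₀ k) →ₗ[k] (Finset V →₀ k) := extendByZero k p
  let e : (Finset V →₀ k) →ₗ[k] (Finset V →₀ k) := LinearMap.id - j ∘ₗ q
  have hj : ∀ T, j (Finsupp.single T 1) = Finsupp.single T.1 1 := fun T => extendByZero_single T 1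
  have hq : ∀ T (hT : p T), q (Finsupp.single T 1) = Finsupp.single ⟨T, hT⟩ 1 :=
    fun T hT => restrictTo_single hT 1
  have hq' : ∀ T, ¬ p T → q (Finsupp.single T 1) = 0 := fun T hT => restrictTo_single_of_not hT 1
  have hqj : ∀ x, q (j x) = x := restrictTo_extendByZero
  have hea : ∀ x, e x = x - j (q x) := fun x => by
    simp only [e, LinearMap.sub_apply, LinearMap.comp_apply, LinearMap.id_apply]
  have he : ∀ T, p T → e (Finsupp.single T 1) = 0 := fun T hT => by
    rw [hea, hq T hT, hj, sub_self]
  have he' : ∀ T, ¬ p T → e (Finsupp.single T 1) = Finsupp.single T 1 := fun T hT => by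
    rw [hea, hq' T hT, map_zero, sub_zero]
  -- Compress the cone identity to `p`. Splitting the identity as `j q + e` between the two
  -- operators gives the compressed homotopy formula, and `R` collects the terms passing through
  -- faces outside `p`.
  let R : ({T // p T} →₀ k) →ₗ[k] ({T // p T} →₀ k) :=
    q ∘ₗ D ∘ₗ e ∘ₗ I ∘ₗ j + q ∘ₗ I ∘ₗ e ∘ₗ D ∘ₗ j
  have hRa : ∀ x, R x = q (D (e (I (j x)))) + q (I (e (D (j x)))) := fun x => by
    simp only [R, LinearMap.add_apply, LinearMap.comp_apply]
  have hR : ∀ x, x = fiberMap p p D (fiberMap p p I x) +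
      fiberMap p p I (fiberMap p p D x) + R x := fun x => by
    have h1 := congrArg q (simplex_contraction g (j x))
    rw [hqj, map_add] at h1
    rw [hRa, hea, hea]
    simp only [fiberMap_apply, map_sub]
    refine h1.symm.trans ?_
    abel
  suffices h : ∃ v, ∀ x, ∃ r : k, R x = r • v by
    obtain ⟨v, hv⟩ := h
    refine ⟨fiberMap p p I, v, fun x => ?_⟩
    obtain ⟨r, hr⟩ := hv x
    exact ⟨r, hr ▸ hR x⟩
  -- Insertion leaves `p` only from the exceptional face, and only if that face does not contain
  -- `g`.
  have first : ∀ T (hT : p T), T ≠ T₀ ∨ g ∈ T →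
      e (I (j (Finsupp.single ⟨T, hT⟩ 1))) = 0 := fun T hT h => by
    rw [hj, simplexInsert_single]
    split_ifs with hg
    · simp
    · have := hp T hT (h.resolve_right hg)
      rw [if_neg hg] at this
      rw [map_smul, he _ this, smul_zero]
  -- Insertion enters `p` from outside only by landing on the exceptional face, which must then
  -- contain `g`.
  have second : ∀ y, q (I (e y)) ∈ Submodule.span k {q (Finsupp.single T₀ 1)} ∧
      (g ∉ T₀ → q (I (e y)) = 0) := fun y => by
    have key : ∀ T, (q ∘ₗ I ∘ₗ e) (Finsupp.single T 1) = 0 ∨ g ∈ T₀ ∧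
        (q ∘ₗ I ∘ₗ e) (Finsupp.single T 1) ∈ Submodule.span k {q (Finsupp.single T₀ 1)} := by
      intro T
      simp only [LinearMap.comp_apply]
      by_cases hT : p T
      · left
        rw [he T hT, map_zero, map_zero]
      · rw [he' T hT, simplexInsert_single]
        split_ifs with hg
        · left
          exact map_zero q
        · rw [map_smul]
          by_cases hT' : p (insert g T)
          · have h0 : insert g T = T₀ := by
              by_contra hne
              have := hp _ hT' hne
              rw [if_pos (Finset.mem_insert_self g T), Finset.erase_insert hg] at this
              exact hT this
            right
            rw [h0]
            exact ⟨h0 ▸ Finset.mem_insert_self g T,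
              Submodule.smul_mem _ _ (Submodule.mem_span_singleton_self _)⟩
          · left
            rw [hq' _ hT', smul_zero]
    have hy : y ∈ Submodule.span k (Set.range fun T => Finsupp.single T (1 : k)) := by
      rw [← Finsupp.coe_basisSingleOne, Module.Basis.span_eq]
      trivial
    constructor
    · refine Submodule.span_le (p := (Submodule.span k {q (Finsupp.single T₀ 1)}).comap
        (q ∘ₗ I ∘ₗ e)) |>.2 ?_ hy
      rintro _ ⟨T, rfl⟩
      rcases key T with h | h
      · exact (Submodule.mem_comap.2 (h ▸ zero_mem _))
      · exact h.2
    · intro hg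
      exact eq_zero_of_single (f := q ∘ₗ I ∘ₗ e)
        (fun T => (key T).resolve_right fun h => hg h.1) y
  by_cases hg : g ∈ T₀
  -- Here `R` has image in the line of `T₀`; in the opposite case below it factors through the
  -- coefficient at `T₀`. Either way its rank is at most one.
  · refine ⟨q (Finsupp.single T₀ 1), fun x => ?_⟩
    have h1 : (e ∘ₗ I ∘ₗ j) x = 0 := eq_zero_of_single (f := e ∘ₗ I ∘ₗ j) (fun T => by
      refine first T.1 T.2 ?_
      by_cases h : T.1 = T₀
      · exact Or.inr (h ▸ hg)
      · exact Or.inl h) x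
    obtain ⟨r, hr⟩ := Submodule.mem_span_singleton.1 (second (D (j x))).1
    refine ⟨r, ?_⟩
    simp only [LinearMap.comp_apply] at h1
    rw [hRa, h1, hr, map_zero, map_zero, zero_add]
  · have hR' : ∀ x, R x = q (D (e (I (j x)))) := fun x => by
      rw [hRa, (second _).2 hg, add_zero]
    by_cases h : p T₀
    · refine ⟨R (Finsupp.single ⟨T₀, h⟩ 1), fun x => ⟨x ⟨T₀, h⟩, ?_⟩⟩
      refine hom_ext_single (f := R)
        (g := (Finsupp.lapply ⟨T₀, h⟩).smulRight (R (Finsupp.single ⟨T₀, h⟩ 1))) (fun T => ?_) x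
      by_cases hT : T = ⟨T₀, h⟩
      · subst hT
        simp
      · have : T.1 ≠ T₀ := fun h' => hT (Subtype.ext h')
        rw [hR', first T.1 T.2 (Or.inl this)]
        simp [hT]
    · refine ⟨0, fun x => ⟨0, ?_⟩⟩
      rw [smul_zero]
      refine eq_zero_of_single (f := R) (fun T => ?_) x
      have : T.1 ≠ T₀ := fun h' => h (h' ▸ T.2)
      rw [hR', first T.1 T.2 (Or.inl this)]
      simp

end Simplex

/-! ### The graded piece of a minimal resolution as the homology of another. -/

theorem finrank_eq_of_retraction {k E W : Type*} [Field k] [AddCommGroup E] [Module k E]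
    [AddCommGroup W] [Module k W] [FiniteDimensional k W] {D H : W →ₗ[k] W} {Φ : E →ₗ[k] W}
    {Ψ : W →ₗ[k] E} (hDD : ∀ x, D (D x) = 0) (hDΦ : ∀ y, D (Φ y) = 0) (hΨD : ∀ x, Ψ (D x) = 0)
    (hΨΦ : ∀ y, Ψ (Φ y) = y) (hH : ∀ x, x = Φ (Ψ x) + (D (H x) + H (D x))) :
    Module.finrank k W = Module.finrank k E + 2 * Module.finrank k (LinearMap.range D) := by
  have h1 := LinearMap.finrank_range_add_finrank_ker D
  have h2 := LinearMap.finrank_range_add_finrank_ker (Ψ.domRestrict (LinearMap.ker D))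
  have h3 : LinearMap.range (Ψ.domRestrict (LinearMap.ker D)) = ⊤ :=
    LinearMap.range_eq_top.2 fun y => ⟨⟨Φ y, hDΦ y⟩, hΨΦ y⟩
  -- On cycles the homotopy formula reads `x = Φ (Ψ x) + D (H x)`, so a cycle killed by `Ψ` is a
  -- boundary. Hence the cycles have dimension that of `E` plus the rank of `D`, and rank-nullity
  -- for `D` adds that rank once more.
  have h4 : (LinearMap.ker (Ψ.domRestrict (LinearMap.ker D))).map (LinearMap.ker D).subtype =
      LinearMap.range D := by
    ext x
    constructor
    · rintro ⟨⟨x, hx⟩, hx', rfl⟩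
      have hx0 : Ψ x = 0 := hx'
      have hx1 : D x = 0 := hx
      refine ⟨H x, ?_⟩
      have := hH x
      rw [hx0, hx1, map_zero, map_zero, zero_add, add_zero] at this
      exact this.symm
    · rintro ⟨x, rfl⟩
      exact ⟨⟨D x, hDD x⟩, hΨD x, rfl⟩
  rw [h3, finrank_top, ← Submodule.finrank_map_subtype_eq, h4] at h2
  omega

namespace StrandResolution

variable {k : Type u} [Field k] {P : Type v} [PartialOrder P] {U : Set P}

theorem Filtered.mdeg_le {C C' : StrandResolution k U} {j : ℕ}
    {f : (C.ι →₀ k) →ₗ[k] (C'.ι →₀ k)} (hf : Filtered C C' j f) (b : C.ι) (c : C'.ι)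
    (h : f (Finsupp.single b 1) c ≠ 0) : C'.mdeg c ≤ C.mdeg b :=
  (mem_strand.1 (hf b) c h).2

theorem Filtered.comp {C C' C'' : StrandResolution k U}
    {f : (C.ι →₀ k) →ₗ[k] (C'.ι →₀ k)} {g : (C'.ι →₀ k) →ₗ[k] (C''.ι →₀ k)}
    (hf : Filtered C C' 0 f) (hg : Filtered C' C'' 0 g) : Filtered C C'' 0 (g ∘ₗ f) :=
  fun b => by
  rw [LinearMap.comp_apply]
  exact map_mem_strand (fun c hc => by simpa [hc] using hg c) (hf b)

theorem Filtered.id_sub {C : StrandResolution k U} {f : (C.ι →₀ k) →ₗ[k] (C.ι →₀ k)}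
    (hf : Filtered C C 0 f) : Filtered C C 0 (LinearMap.id - f) :=
  fun b => sub_mem (single_mem_strand rfl le_rfl 1) (hf b)

/-- The part of multidegree exactly `l` of a map between resolutions. -/
abbrev fiber (C C' : StrandResolution k U) (l : P) (f : (C.ι →₀ k) →ₗ[k] (C'.ι →₀ k)) :
    ({b // C.mdeg b = l} →₀ k) →ₗ[k] ({b // C'.mdeg b = l} →₀ k) :=
  fiberMap (fun b => C.mdeg b = l) (fun b => C'.mdeg b = l) f

theorem Minimal.fiber_d {C : StrandResolution k U} (hC : C.Minimal) (l : P) :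
    fiberMap (fun b => C.mdeg b = l) (fun b => C.mdeg b = l) C.d = 0 := by
  refine LinearMap.ext fun x => eq_zero_of_single (fun b => ?_) x
  ext c
  rw [fiberMap_apply, extendByZero_single, restrictTo_apply, hC _ _ (c.2.trans b.2.symm),
    Finsupp.zero_apply]

theorem fiber_d_d (C : StrandResolution k U) (l : P) (x) :
    fiber C C l C.d (fiber C C l C.d x) = 0 := by
  have hd : ∀ b c, C.d (Finsupp.single b 1) c ≠ 0 → C.mdeg c ≤ C.mdeg b :=
    fun b c h => (C.d_single b c h).2
  rw [← LinearMap.comp_apply, ← fiberMap_comp l hd hd]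
  have : C.d ∘ₗ C.d = 0 := LinearMap.ext C.d_d
  rw [this]
  simp [fiberMap]

/-- The difference between the identity and `ψ φ` lifts the zero augmentation, hence is
null-homotopic; the filtered homotopy descends to multidegree `l` by `fiberMap_comp`. -/
theorem exists_fiber_homotopy (hU : IsUpperSet U) (C C' : StrandResolution k U)
    {φ : (C.ι →₀ k) →ₗ[k] (C'.ι →₀ k)} {ψ : (C'.ι →₀ k) →ₗ[k] (C.ι →₀ k)}
    (hφ : Filtered C C' 0 φ) (hφd : ∀ x, φ (C.d x) = C'.d (φ x))
    (hφε : ∀ b, C.deg b = 0 → C.mdeg b ∉ U →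
      C'.ε (φ (Finsupp.single b 1)) = C.ε (Finsupp.single b 1))
    (hψ : Filtered C' C 0 ψ) (hψd : ∀ x, ψ (C'.d x) = C.d (ψ x))
    (hψε : ∀ b, C'.deg b = 0 → C'.mdeg b ∉ U →
      C.ε (ψ (Finsupp.single b 1)) = C'.ε (Finsupp.single b 1)) (l : P) :
    ∃ H : ({b // C.mdeg b = l} →₀ k) →ₗ[k] ({b // C.mdeg b = l} →₀ k),
      ∀ x, x = fiber C' C l ψ (fiber C C' l φ x) +
      (fiber C C l C.d (H x) + H (fiber C C l C.d x)) := by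
  obtain ⟨h, hh, hh'⟩ := exists_homotopy C C (hφ.comp hψ).id_sub
    (fun x => by simp [hφd, hψd]) (fun b hb hbU => by
      have h1 : φ (Finsupp.single b 1) ∈ strand k C'.deg C'.mdeg 0 (C.mdeg b) := by
        simpa [hb] using hφ b
      simp only [LinearMap.sub_apply, LinearMap.id_apply, LinearMap.comp_apply, map_sub]
      rw [ε_eq_of_single hU C' C hψε hbU h1, hφε b hb hbU, sub_self])
  refine ⟨fiber C C l h, fun x => ?_⟩
  have hd : ∀ b c, C.d (Finsupp.single b 1) c ≠ 0 → C.mdeg c ≤ C.mdeg b :=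
    fun b c h => (C.d_single b c h).2
  have key : LinearMap.id - ψ ∘ₗ φ = C.d ∘ₗ h + h ∘ₗ C.d := LinearMap.ext hh'
  have key' := congrArg (fiber C C l) key
  rw [fiber, fiber, fiberMap_sub, fiberMap_add, fiberMap_id, fiberMap_comp l hφ.mdeg_le hψ.mdeg_le,
    fiberMap_comp l hh.mdeg_le hd, fiberMap_comp l hd hh.mdeg_le] at key'
  have := LinearMap.congr_fun key' x
  simp only [LinearMap.sub_apply, LinearMap.add_apply, LinearMap.comp_apply,
    LinearMap.id_apply] at this
  exact (sub_eq_iff_eq_add'.1 this)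

/-- The part of multidegree `l` of any resolution retracts onto that of a minimal one. -/
theorem Minimal.exists_retraction (hU : IsUpperSet U) {C : StrandResolution k U}
    (hC : C.Minimal) (C' : StrandResolution k U) (l : P) :
    ∃ (Φ : ({b // C.mdeg b = l} →₀ k) →ₗ[k] ({b // C'.mdeg b = l} →₀ k))
      (Ψ : ({b // C'.mdeg b = l} →₀ k) →ₗ[k] ({b // C.mdeg b = l} →₀ k))
      (H : ({b // C'.mdeg b = l} →₀ k) →ₗ[k] ({b // C'.mdeg b = l} →₀ k)),
      (∀ y, fiber C' C' l C'.d (Φ y) = 0) ∧ (∀ x, Ψ (fiber C' C' l C'.d x) = 0) ∧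
      (∀ y, Ψ (Φ y) = y) ∧
      ∀ x, x = Φ (Ψ x) + (fiber C' C' l C'.d (H x) + H (fiber C' C' l C'.d x)) := by
  obtain ⟨φ, hφ, hφd, hφε⟩ := exists_chainMap hU C C'
  obtain ⟨ψ, hψ, hψd, hψε⟩ := exists_chainMap hU C' C
  obtain ⟨H, hH⟩ := exists_fiber_homotopy hU C' C hψ hψd hψε hφ hφd hφε l
  obtain ⟨H', hH'⟩ := exists_fiber_homotopy hU C C' hφ hφd hφε hψ hψd hψε l
  have hd : ∀ b c, C.d (Finsupp.single b 1) c ≠ 0 → C.mdeg c ≤ C.mdeg b :=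
    fun b c h => (C.d_single b c h).2
  have hd' : ∀ b c, C'.d (Finsupp.single b 1) c ≠ 0 → C'.mdeg c ≤ C'.mdeg b :=
    fun b c h => (C'.d_single b c h).2
  refine ⟨fiber C C' l φ, fiber C' C l ψ, H, fun y => ?_, fun x => ?_, fun y => ?_, hH⟩
  · have : C'.d ∘ₗ φ = φ ∘ₗ C.d := LinearMap.ext fun x => (hφd x).symm
    have := congrArg (fiber C C' l) this
    rw [fiber, fiber, fiberMap_comp l hφ.mdeg_le hd', fiberMap_comp l hd hφ.mdeg_le, hC.fiber_d,
      LinearMap.comp_zero] at this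
    exact LinearMap.congr_fun this y
  · have : ψ ∘ₗ C'.d = C.d ∘ₗ ψ := LinearMap.ext hψd
    have := congrArg (fiber C' C l) this
    rw [fiber, fiber, fiberMap_comp l hψ.mdeg_le hd, fiberMap_comp l hd' hψ.mdeg_le, hC.fiber_d,
      LinearMap.zero_comp] at this
    exact LinearMap.congr_fun this x
  · have := hH' y
    have h0 : fiber C C l C.d = 0 := hC.fiber_d l
    rw [h0, LinearMap.zero_apply, LinearMap.zero_apply, map_zero, add_zero,
      add_zero] at this
    exact this.symm

end StrandResolution

/-- The Taylor piece at `l` retracts onto that of `C`. The dimension formula gives the parity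
statement; applying the rank-one contraction to the cycles `Φ y` and then `Ψ` shows that every `y`
is a multiple of the single vector `Ψ v`. -/
theorem StrandResolution.Minimal.card_fiber {k : Type u} [Field k] {P : Type v}
    [SemilatticeSup P] [OrderBot P] {U : Set P} {V : Type} [LinearOrder V] [Finite V] {g : V → P}
    (hg : ∀ v, g v ∈ U) (hU : IsUpperSet U) (hU' : ∀ a ∈ U, ∃ v, g v ≤ a)
    {C : StrandResolution k U} (hC : C.Minimal) (l : P)
    (hp : (∃ T₀ : Finset V, ∀ T : Finset V, T.sup g = l → T = T₀) ∨
      ∃ (v : V) (T₀ : Finset V), ∀ T : Finset V, T.sup g = l → T ≠ T₀ →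
        if v ∈ T then (T.erase v).sup g = l else (insert v T).sup g = l) :
    Finite {b // C.mdeg b = l} ∧ Nat.card {b // C.mdeg b = l} ≤ 1 ∧
      ∃ r, Nat.card {T : Finset V // T.sup g = l} = Nat.card {b // C.mdeg b = l} + 2 * r := by
  have hI : ∃ (R : StrandResolution k U), Nat.card {T : Finset V // T.sup g = l} =
      Nat.card {b // R.mdeg b = l} ∧ Finite {b // R.mdeg b = l} ∧
      ∃ (I : ({b // R.mdeg b = l} →₀ k) →ₗ[k] ({b // R.mdeg b = l} →₀ k))
        (v : {b // R.mdeg b = l} →₀ k), ∀ x, ∃ r : k,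
        x = fiber R R l R.d (I x) + I (fiber R R l R.d x) + r • v :=
    ⟨taylorResolution k g U hg hU hU', rfl,
      inferInstanceAs (Finite {T : Finset V // T.sup g = l}),
      exists_contraction_error (k := k) (fun T => T.sup g = l) hp⟩
  obtain ⟨R, hcard, hfin, I, v, hI⟩ := hI
  obtain ⟨Φ, Ψ, H, h1, h2, h3, h4⟩ := hC.exists_retraction hU R l
  have hfd : FiniteDimensional k ({b // C.mdeg b = l} →₀ k) :=
    Module.Finite.of_surjective Ψ fun y => ⟨Φ y, h3 y⟩
  have hfC : Finite {b // C.mdeg b = l} :=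
    Module.Finite.finite_basis (Finsupp.basisSingleOne (R := k))
  have := Fintype.ofFinite {b // C.mdeg b = l}
  have := Fintype.ofFinite {b // R.mdeg b = l}
  refine ⟨hfC, ?_, ?_⟩
  · have : Module.finrank k ({b // C.mdeg b = l} →₀ k) ≤ 1 := by
      refine finrank_le_one (Ψ v) fun y => ?_
      obtain ⟨r, hr⟩ := hI (Φ y)
      refine ⟨r, ?_⟩
      rw [h1, map_zero, add_zero] at hr
      have h5 := congrArg Ψ hr
      rw [h3, map_add, map_smul, h2, zero_add] at h5
      exact h5.symm
    rwa [Module.finrank_finsupp_self, ← Nat.card_eq_fintype_card] at this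
  · have := finrank_eq_of_retraction (fiber_d_d _ l) h1 h2 h3 h4
    rw [Module.finrank_finsupp_self, Module.finrank_finsupp_self, ← Nat.card_eq_fintype_card,
      ← Nat.card_eq_fintype_card] at this
    exact ⟨_, hcard.trans this⟩

/-! ### Homogeneous maps of multigraded free modules and their dehomogenization. -/

section Homogeneous

variable {k : Type u} [Field k] {n : ℕ} {κ κ' : Type}

/-- The coefficient vector of the component of multidegree `a` of an element of the multigraded
free module with basis degrees `m`. -/
def strandPart (k : Type u) [Field k] (m : κ → Fin n →₀ ℕ) (a : Fin n →₀ ℕ) :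
    (κ →₀ MvPolynomial (Fin n) k) →ₗ[k] (κ →₀ k) where
  toFun f := Finsupp.onFinset f.support (fun c => if m c ≤ a then coeff (a - m c) (f c) else 0)
    (fun c hc => Finsupp.mem_support_iff.2 fun h => hc (by simp [h]))
  map_add' f g := by
    ext c
    simp only [Finsupp.onFinset_apply, Finsupp.add_apply, coeff_add]
    split_ifs <;> simp
  map_smul' r f := by
    ext c
    simp

/-- The homogeneous element of multidegree `a` with a given coefficient vector. -/
def homogenize (k : Type u) [Field k] (m : κ → Fin n →₀ ℕ) (a : Fin n →₀ ℕ) :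
    (κ →₀ k) →ₗ[k] (κ →₀ MvPolynomial (Fin n) k) where
  toFun x := Finsupp.onFinset x.support (fun c => monomial (a - m c) (x c))
    (fun c hc => Finsupp.mem_support_iff.2 fun h => hc (by simp [h]))
  map_add' f g := by
    ext c
    simp
  map_smul' r f := by
    ext c
    simp

variable {m : κ → Fin n →₀ ℕ} {m' : κ' → Fin n →₀ ℕ} {a a' : Fin n →₀ ℕ}

theorem strandPart_apply (f : κ →₀ MvPolynomial (Fin n) k) (c : κ) :
    strandPart k m a f c = if m c ≤ a then coeff (a - m c) (f c) else 0 :=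
  rfl

theorem homogenize_apply (x : κ →₀ k) (c : κ) :
    homogenize k m a x c = monomial (a - m c) (x c) :=
  rfl

theorem strandPart_mem (f : κ →₀ MvPolynomial (Fin n) k) :
    strandPart k m a f ∈ Finsupp.supported k k {c | m c ≤ a} := by
  refine (Finsupp.mem_supported _ _).2 fun c hc => ?_
  by_contra h
  have h' : ¬ m c ≤ a := h
  simp [strandPart_apply, h'] at hc

/-- The support hypothesis is needed because `a - m c` is truncated: without `m c ≤ a` the entry of
`homogenize` would not have multidegree `a`. -/
theorem strandPart_homogenize {x : κ →₀ k} (hx : x ∈ Finsupp.supported k k {c | m c ≤ a}) :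
    strandPart k m a' (homogenize k m a x) = if a' = a then x else 0 := by
  classical
  ext c
  rw [strandPart_apply, homogenize_apply, coeff_monomial]
  by_cases hc : x c = 0
  · split_ifs <;> simp [hc]
  · have hca : m c ≤ a := (Finsupp.mem_supported _ _).1 hx (by simpa using hc)
    by_cases h : a' = a
    · subst h
      simp [hca]
    · rw [if_neg h, Finsupp.zero_apply]
      split_ifs with h1 h2
      · exact absurd ((tsub_left_inj hca h1).1 h2).symm h
      · rfl
      · rfl

theorem ext_strandPart {f g : κ →₀ MvPolynomial (Fin n) k}
    (h : ∀ a, strandPart k m a f = strandPart k m a g) : f = g := by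
  ext c u
  have := DFunLike.congr_fun (h (u + m c)) c
  simpa [strandPart_apply] using this

theorem strandPart_single (b : κ) :
    strandPart k m (m b) (Finsupp.single b 1) = Finsupp.single b 1 := by
  classical
  ext c
  rw [strandPart_apply]
  by_cases h : b = c
  · subst h
    simp
  · simp [Finsupp.single_eq_of_ne' h]

theorem strandPart_single_monomial (b : κ) (u : Fin n →₀ ℕ) (r : k) :
    strandPart k m a (Finsupp.single b (monomial u r)) =
      Finsupp.single b (if u + m b = a then r else 0) := by
  classical
  ext c
  rw [strandPart_apply]
  by_cases h : b = c
  · subst h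
    rw [Finsupp.single_eq_same, Finsupp.single_eq_same, coeff_monomial]
    by_cases h1 : u + m b = a
    · subst h1
      simp
    · rw [if_neg h1]
      split_ifs with h2 h3
      · exact absurd (by rw [h3, tsub_add_cancel_of_le h2]) h1
      · rfl
      · rfl
  · simp [Finsupp.single_eq_of_ne' h]

theorem additive_ext_single_monomial {A : Type*} [AddCommMonoid A]
    {φ ψ : (κ →₀ MvPolynomial (Fin n) k) →+ A}
    (h : ∀ b u r, φ (Finsupp.single b (monomial u r)) = ψ (Finsupp.single b (monomial u r)))
    (f : κ →₀ MvPolynomial (Fin n) k) : φ f = ψ f := by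
  induction f using Finsupp.induction_linear with
  | zero => simp
  | add f g hf hg => rw [map_add, map_add, hf, hg]
  | single b p =>
    induction p using MvPolynomial.induction_on' with
    | monomial u r => exact h b u r
    | add p q hp hq => rw [Finsupp.single_add, map_add, map_add, hp, hq]

/-- `D` is obtained from the homogeneous map `d` by setting all variables to `1`. -/
def IsDehomogenization (m : κ → Fin n →₀ ℕ) (m' : κ' → Fin n →₀ ℕ)
    (d : (κ →₀ MvPolynomial (Fin n) k) →ₗ[MvPolynomial (Fin n) k]
      (κ' →₀ MvPolynomial (Fin n) k)) (D : (κ →₀ k) →ₗ[k] (κ' →₀ k)) : Prop :=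
  ∀ b c, d (Finsupp.single b 1) c = monomial (m b - m' c) (D (Finsupp.single b 1) c) ∧
    (D (Finsupp.single b 1) c ≠ 0 → m' c ≤ m b)

section

variable {d : (κ →₀ MvPolynomial (Fin n) k) →ₗ[MvPolynomial (Fin n) k]
  (κ' →₀ MvPolynomial (Fin n) k)} {D : (κ →₀ k) →ₗ[k] (κ' →₀ k)}

/-- A homogeneous map of degree zero preserves multidegrees, so it acts on each component through
its scalar matrix. This carries exactness between modules and strands. -/
theorem IsDehomogenization.strandPart_comm (h : IsDehomogenization m m' d D)
    (f : κ →₀ MvPolynomial (Fin n) k) : strandPart k m' a (d f) = D (strandPart k m a f) := by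
  classical
  refine additive_ext_single_monomial
    (φ := (strandPart k m' a).toAddMonoidHom.comp d.toAddMonoidHom)
    (ψ := D.toAddMonoidHom.comp (strandPart k m a).toAddMonoidHom) (fun b u r => ?_) f
  change strandPart k m' a (d _) = D (strandPart k m a _)
  have h1 : (Finsupp.single b (monomial u r) : κ →₀ MvPolynomial (Fin n) k) =
      monomial u r • Finsupp.single b 1 := by simp
  have h2 : ∀ t : k, (Finsupp.single b t : κ →₀ k) = t • Finsupp.single b 1 := by simp
  rw [strandPart_single_monomial, h2, h1, d.map_smul, D.map_smul]
  ext c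
  obtain ⟨h3, h4⟩ := h b c
  rw [strandPart_apply, Finsupp.smul_apply, Finsupp.smul_apply, h3, smul_eq_mul, monomial_mul,
    smul_eq_mul, coeff_monomial]
  by_cases hs : D (Finsupp.single b 1) c = 0
  · simp [hs]
  · have hle := h4 hs
    by_cases h5 : u + m b = a
    · subst h5
      rw [if_pos (hle.trans (by simp)), if_pos (add_tsub_assoc_of_le hle u).symm, if_pos rfl]
    · rw [if_neg h5, zero_mul]
      split_ifs with h6 h7
      · refine absurd ?_ h5
        rw [← add_tsub_assoc_of_le hle] at h7
        exact (tsub_left_inj (hle.trans (by simp)) h6).1 h7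
      · rfl
      · rfl

theorem IsDehomogenization.map_homogenize (h : IsDehomogenization m m' d D) {x : κ →₀ k}
    (hx : x ∈ Finsupp.supported k k {c | m c ≤ a}) :
    d (homogenize k m a x) = homogenize k m' a (D x) := by
  have hDx : D x ∈ Finsupp.supported k k {c | m' c ≤ a} := by
    have := h.strandPart_comm (a := a) (homogenize k m a x)
    rw [strandPart_homogenize hx, if_pos rfl] at this
    rw [← this]
    exact strandPart_mem _
  refine ext_strandPart (m := m') fun a' => ?_
  rw [h.strandPart_comm, strandPart_homogenize hx, strandPart_homogenize hDx]
  split_ifs <;> simp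

theorem sum_homogenize_strandPart (f : κ →₀ MvPolynomial (Fin n) k) :
    ∃ A : Finset (Fin n →₀ ℕ), f = ∑ a ∈ A, homogenize k m a (strandPart k m a f) := by
  classical
  -- The multidegrees `u + m c` of the terms of `f`.
  refine ⟨f.support.biUnion fun c => (f c).support.image (· + m c),
    ext_strandPart (m := m) fun a' => ?_⟩
  rw [map_sum]
  simp only [strandPart_homogenize (strandPart_mem f)]
  rw [Finset.sum_ite_eq]
  split_ifs with h
  · rfl
  · ext c
    rw [strandPart_apply, Finsupp.zero_apply]
    split_ifs with hc
    · by_contra hne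
      refine h (Finset.mem_biUnion.2 ⟨c, ?_, Finset.mem_image.2 ⟨a' - m c, ?_, ?_⟩⟩)
      · rw [Finsupp.mem_support_iff]
        rintro h0
        simp [h0] at hne
      · exact mem_support_iff.2 hne
      · exact tsub_add_cancel_of_le hc
    · rfl

/-- An element is the finite sum of its homogeneous components, so preimages may be found one
multidegree at a time. -/
theorem IsDehomogenization.mem_range (h : IsDehomogenization m m' d D)
    {f : κ' →₀ MvPolynomial (Fin n) k}
    (hf : ∀ a, ∃ w ∈ Finsupp.supported k k {c | m c ≤ a}, D w = strandPart k m' a f) :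
    f ∈ LinearMap.range d := by
  obtain ⟨A, hA⟩ := sum_homogenize_strandPart (m := m') f
  rw [hA]
  refine Submodule.sum_mem _ fun a _ => ?_
  obtain ⟨w, hw, hw'⟩ := hf a
  exact ⟨homogenize k m a w, by rw [h.map_homogenize hw, hw']⟩

theorem isDehomogenization_linearCombination (D : (κ →₀ k) →ₗ[k] (κ' →₀ k))
    (hD : ∀ b c, D (Finsupp.single b 1) c ≠ 0 → m' c ≤ m b) :
    IsDehomogenization m m' (Finsupp.linearCombination (MvPolynomial (Fin n) k)
      fun b => homogenize k m' (m b) (D (Finsupp.single b 1))) D :=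
  fun b c => ⟨by simp [homogenize_apply], hD b c⟩

theorem exists_isDehomogenization
    (hd : ∀ b c, ∀ u ∈ (d (Finsupp.single b 1) c).support, u + m' c = m b) :
    ∃ D, IsDehomogenization m m' d D := by
  classical
  refine ⟨Finsupp.linearCombination k fun b => strandPart k m' (m b) (d (Finsupp.single b 1)),
    fun b c => ?_⟩
  rw [Finsupp.linearCombination_single, one_smul, strandPart_apply]
  constructor
  · ext u
    rw [coeff_monomial]
    by_cases hu : u ∈ (d (Finsupp.single b 1) c).support
    · have h := hd b c u hu
      rw [if_pos (by rw [← h]; simp), if_pos (by rw [← h]; simp), ← h]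
      simp
    · rw [notMem_support_iff.1 hu]
      split_ifs with h1 h2
      · rw [h1, notMem_support_iff.1 hu]
      · rfl
      · rfl
  · intro h
    by_contra hle
    exact h (if_neg hle)

end

/-- The homogeneous functional with coefficients `ε`. -/
def homogenizeFunctional (m : κ → Fin n →₀ ℕ) (ε : (κ →₀ k) →ₗ[k] k) :
    (κ →₀ MvPolynomial (Fin n) k) →ₗ[MvPolynomial (Fin n) k] MvPolynomial (Fin n) k :=
  Finsupp.linearCombination _ fun b => monomial (m b) (ε (Finsupp.single b 1))

theorem coeff_homogenizeFunctional (ε : (κ →₀ k) →ₗ[k] k)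
    (f : κ →₀ MvPolynomial (Fin n) k) :
    coeff a (homogenizeFunctional m ε f) = ε (strandPart k m a f) := by
  classical
  refine additive_ext_single_monomial
    (φ := (coeffAddMonoidHom a).comp (homogenizeFunctional m ε).toAddMonoidHom)
    (ψ := ε.toAddMonoidHom.comp (strandPart k m a).toAddMonoidHom) (fun b u r => ?_) f
  change coeff a (homogenizeFunctional m ε _) = ε (strandPart k m a _)
  have h2 : ∀ t : k, (Finsupp.single b t : κ →₀ k) = t • Finsupp.single b 1 := by simp
  rw [strandPart_single_monomial, homogenizeFunctional, Finsupp.linearCombination_single,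
    smul_eq_mul, monomial_mul, coeff_monomial]
  split_ifs
  · rw [h2 r, map_smul, smul_eq_mul]
  · simp

end Homogeneous

/-! ### Monomial ideals and their exponent sets. -/

section MonomialIdeal

variable {k : Type u} [Field k] {n : ℕ} {M : Ideal (MvPolynomial (Fin n) k)}

/-- The exponents of the monomials in `M`. -/
def exponents (M : Ideal (MvPolynomial (Fin n) k)) : Set (Fin n →₀ ℕ) :=
  {a | monomial a (1 : k) ∈ M}

theorem isUpperSet_exponents : IsUpperSet (exponents M) := by
  intro a b hab ha
  have : monomial b (1 : k) = monomial (b - a) 1 * monomial a 1 := by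
    rw [monomial_mul, tsub_add_cancel_of_le hab, one_mul]
  change monomial b (1 : k) ∈ M
  rw [this]
  exact M.mul_mem_left _ ha

theorem monomial_mem_of_exponents {a : Fin n →₀ ℕ} (ha : a ∈ exponents M) (r : k) :
    monomial a r ∈ M := by
  have : monomial a r = C r * monomial a 1 := by rw [C_mul_monomial, mul_one]
  rw [this]
  exact M.mul_mem_left _ ha

theorem IsMonomialIdeal.mem_iff (hM : IsMonomialIdeal M) {p : MvPolynomial (Fin n) k} :
    p ∈ M ↔ ∀ a, a ∉ exponents M → coeff a p = 0 := by
  constructor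
  · obtain ⟨A, rfl⟩ := hM
    intro hp a ha
    by_contra hne
    obtain ⟨b, hb, hba⟩ := mem_ideal_span_monomial_image.1 hp a (mem_support_iff.2 hne)
    exact ha (isUpperSet_exponents hba (Ideal.subset_span ⟨b, hb, rfl⟩))
  · intro h
    rw [p.as_sum]
    refine Ideal.sum_mem _ fun a ha => monomial_mem_of_exponents ?_ _
    by_contra h'
    exact mem_support_iff.1 ha (h a h')

end MonomialIdeal

/-! ### From strands to multigraded resolutions. -/

section FromStrands

variable {k : Type u} [Field k] {n : ℕ} {M : Ideal (MvPolynomial (Fin n) k)}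

theorem extendByZero_restrictTo {ι : Type} {p : ι → Prop} {x : ι →₀ k} (hx : ∀ b, x b ≠ 0 → p b) :
    extendByZero k p (restrictTo k p x) = x := by
  ext b
  by_cases hb : p b
  · rw [show b = (⟨b, hb⟩ : {b // p b}).1 from rfl, extendByZero_apply]
    rfl
  · rw [extendByZero_apply_of_not _ hb]
    by_contra h
    exact hb (hx b (Ne.symm h))

namespace StrandResolution

variable (C : StrandResolution k (exponents M))

/-- The differential in a single homological degree. -/
abbrev dDeg (i : ℕ) : ({b // C.deg b = i + 1} →₀ k) →ₗ[k] ({b // C.deg b = i} →₀ k) :=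
  fiberMap (fun b => C.deg b = i + 1) (fun b => C.deg b = i) C.d

variable {C}

theorem extendByZero_mem_strand {i : ℕ} {a : Fin n →₀ ℕ} {x : {b // C.deg b = i} →₀ k}
    (hx : x ∈ Finsupp.supported k k {b : {b // C.deg b = i} | C.mdeg b.1 ≤ a}) :
    extendByZero k _ x ∈ strand k C.deg C.mdeg i a := by
  refine mem_strand.2 fun b hb => ?_
  by_cases h : C.deg b = i
  · refine ⟨h, ?_⟩
    rw [show b = (⟨b, h⟩ : {b // C.deg b = i}).1 from rfl, extendByZero_apply] at hb
    exact (Finsupp.mem_supported _ _).1 hx (by simpa using hb)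
  · exact absurd (extendByZero_apply_of_not (p := fun b => C.deg b = i) _ h) hb

theorem restrictTo_mem {i : ℕ} {a : Fin n →₀ ℕ} {x : C.ι →₀ k}
    (hx : x ∈ strand k C.deg C.mdeg i a) :
    restrictTo k (fun b => C.deg b = i) x ∈
      Finsupp.supported k k {b : {b // C.deg b = i} | C.mdeg b.1 ≤ a} := by
  refine (Finsupp.mem_supported _ _).2 fun b hb => ?_
  have h : restrictTo k (fun b => C.deg b = i) x b ≠ 0 := Finsupp.mem_support_iff.1 hb
  exact (mem_strand.1 hx b.1 h).2

theorem extendByZero_mem_strand_sup {i : ℕ} (x : {b // C.deg b = i} →₀ k) :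
    ∃ a, extendByZero k _ x ∈ strand k C.deg C.mdeg i a :=
  ⟨x.support.sup fun b => C.mdeg b.1, extendByZero_mem_strand
    ((Finsupp.mem_supported _ _).2 fun _ hb =>
      Finset.le_sup (f := fun b : {b // C.deg b = i} => C.mdeg b.1) hb)⟩

theorem extendByZero_dDeg {i : ℕ} (x : {b // C.deg b = i + 1} →₀ k) :
    extendByZero k _ (C.dDeg i x) = C.d (extendByZero k _ x) := by
  obtain ⟨a, ha⟩ := extendByZero_mem_strand_sup x
  exact extendByZero_restrictTo fun b hb => (mem_strand.1 (C.d_mem ha) b hb).1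

theorem dDeg_dDeg {i : ℕ} (x : {b // C.deg b = i + 2} →₀ k) :
    C.dDeg i (C.dDeg (i + 1) x) = 0 := by
  change restrictTo k _ (C.d (extendByZero k _ (C.dDeg (i + 1) x))) = 0
  rw [extendByZero_dDeg, C.d_d, map_zero]

theorem dDeg_exact {i : ℕ} {a : Fin n →₀ ℕ} {x : {b // C.deg b = i} →₀ k}
    (hx : x ∈ Finsupp.supported k k {b : {b // C.deg b = i} | C.mdeg b.1 ≤ a})
    (hd : C.d (extendByZero k _ x) = 0)
    (hε : i = 0 → a ∉ exponents M → C.ε (extendByZero k _ x) = 0) :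
    ∃ w ∈ Finsupp.supported k k {b : {b // C.deg b = i + 1} | C.mdeg b.1 ≤ a}, C.dDeg i w = x := by
  obtain ⟨y, hy, hy'⟩ := C.exact i a _ (extendByZero_mem_strand hx) hd hε
  refine ⟨_, restrictTo_mem hy, ?_⟩
  change restrictTo k _ (C.d (extendByZero k _ (restrictTo k _ y))) = x
  rw [extendByZero_restrictTo fun b hb => (mem_strand.1 hy b hb).1, hy', restrictTo_extendByZero]

variable (C)

/-- The matrix of the homogenized differential. -/
def homogenizedD (i : ℕ) : ({b // C.deg b = i + 1} →₀ MvPolynomial (Fin n) k)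
    →ₗ[MvPolynomial (Fin n) k] ({b // C.deg b = i} →₀ MvPolynomial (Fin n) k) :=
  Finsupp.linearCombination (MvPolynomial (Fin n) k) fun b =>
    homogenize k (fun c : {b // C.deg b = i} => C.mdeg c.1) (C.mdeg b.1)
      (C.dDeg i (Finsupp.single b 1))

theorem isDehomogenization_homogenizedD (i : ℕ) :
    IsDehomogenization (fun b : {b // C.deg b = i + 1} => C.mdeg b.1)
      (fun c : {b // C.deg b = i} => C.mdeg c.1) (C.homogenizedD i) (C.dDeg i) :=
  isDehomogenization_linearCombination _ fun b c hc => by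
    rw [fiberMap_apply, extendByZero_single, restrictTo_apply] at hc
    exact (C.d_single _ _ hc).2

/-- The augmentation of the homogenized resolution, before passing to the quotient. -/
def homogenizedAug : ({b // C.deg b = 0} →₀ MvPolynomial (Fin n) k)
    →ₗ[MvPolynomial (Fin n) k] MvPolynomial (Fin n) k :=
  homogenizeFunctional (fun b : {b // C.deg b = 0} => C.mdeg b.1) (C.ε ∘ₗ extendByZero k _)

variable {C}

theorem homogenizedAug_mem_iff (hM : IsMonomialIdeal M)
    (f : {b // C.deg b = 0} →₀ MvPolynomial (Fin n) k) :
    C.homogenizedAug f ∈ M ↔ ∀ a, a ∉ exponents M → C.ε (extendByZero k _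
      (strandPart k (fun b : {b // C.deg b = 0} => C.mdeg b.1) a f)) = 0 := by
  rw [hM.mem_iff]
  simp only [homogenizedAug, coeff_homogenizeFunctional, LinearMap.comp_apply]

theorem exists_homogenizedAug_eq (a : Fin n →₀ ℕ) (ha : a ∉ exponents M) (r : k) :
    ∃ f, C.homogenizedAug f = monomial a r := by
  classical
  obtain ⟨x, hx, hx'⟩ := C.ε_surjective a ha
  refine ⟨homogenize k (fun b : {b // C.deg b = 0} => C.mdeg b.1) a
    (r • restrictTo k (fun b => C.deg b = 0) x), ?_⟩
  ext a'
  rw [homogenizedAug, coeff_homogenizeFunctional,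
    strandPart_homogenize (Submodule.smul_mem _ _ (restrictTo_mem hx)), coeff_monomial]
  by_cases h : a' = a
  · rw [if_pos h, if_pos h.symm, LinearMap.comp_apply, map_smul,
      extendByZero_restrictTo fun b hb => (mem_strand.1 hx b hb).1, map_smul, hx', smul_eq_mul,
      mul_one]
  · rw [if_neg h, if_neg (Ne.symm h), map_zero]

variable (C)

/-- The multigraded free resolution with the given strands. -/
def toMultigraded (hM : IsMonomialIdeal M) [Finite C.ι] : MultigradedFreeResolution M where
  ι i := {b // C.deg b = i}
  finite i := inferInstance
  mdeg i b := C.mdeg b.1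
  d := C.homogenizedD
  aug := (Submodule.mkQ M) ∘ₗ C.homogenizedAug
  d_homogeneous i b c u hu := by
    classical
    obtain ⟨h1, h2⟩ := C.isDehomogenization_homogenizedD i b c
    rw [h1, mem_support_iff, coeff_monomial] at hu
    split_ifs at hu with h
    · rw [← h]
      exact tsub_add_cancel_of_le (h2 hu)
    · exact absurd rfl hu
  aug_homogeneous b := ⟨C.ε (Finsupp.single b.1 1), by
    rw [LinearMap.comp_apply, homogenizedAug, homogenizeFunctional,
      Finsupp.linearCombination_single, one_smul, LinearMap.comp_apply, extendByZero_single]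
    rfl⟩
  aug_surjective := by
    rw [← LinearMap.range_eq_top, eq_top_iff]
    rintro x -
    obtain ⟨p, rfl⟩ := Submodule.mkQ_surjective M x
    rw [p.as_sum, map_sum]
    refine Submodule.sum_mem _ fun a _ => ?_
    by_cases ha : a ∈ exponents M
    · have : M.mkQ (monomial a (coeff a p)) = 0 :=
        (Submodule.Quotient.mk_eq_zero M).2 (monomial_mem_of_exponents ha _)
      rw [this]
      exact zero_mem _
    · obtain ⟨f, hf⟩ := exists_homogenizedAug_eq (C := C) a ha (coeff a p)
      exact ⟨f, by rw [LinearMap.comp_apply, hf]⟩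
  exact_zero y := by
    have haug : (M.mkQ ∘ₗ C.homogenizedAug) y = 0 ↔ C.homogenizedAug y ∈ M :=
      Submodule.Quotient.mk_eq_zero M
    rw [haug, homogenizedAug_mem_iff hM]
    constructor
    · intro h
      refine (C.isDehomogenization_homogenizedD 0).mem_range fun a => ?_
      have := strandPart_mem (m := fun b : {b // C.deg b = 0} => C.mdeg b.1) (a := a) y
      exact dDeg_exact this (C.d_eq_zero (extendByZero_mem_strand this)) fun _ ha => h a ha
    · rintro ⟨z, rfl⟩ a ha
      rw [(C.isDehomogenization_homogenizedD 0).strandPart_comm, extendByZero_dDeg]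
      exact eq_on_strand (f := C.ε ∘ₗ C.d) (g := 0)
        (fun b hb hb' => C.ε_d b hb fun h => ha (isUpperSet_exponents hb' h))
        (extendByZero_mem_strand (strandPart_mem z))
  exact_succ i y := by
    constructor
    · intro h
      refine (C.isDehomogenization_homogenizedD (i + 1)).mem_range fun a => ?_
      have := strandPart_mem (m := fun b : {b // C.deg b = i + 1} => C.mdeg b.1) (a := a) y
      refine dDeg_exact this ?_ (by omega)
      rw [← extendByZero_dDeg, ← (C.isDehomogenization_homogenizedD i).strandPart_comm, h,
        map_zero, map_zero]
    · rintro ⟨z, rfl⟩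
      refine ext_strandPart (m := fun b : {b // C.deg b = i} => C.mdeg b.1) fun a => ?_
      rw [(C.isDehomogenization_homogenizedD i).strandPart_comm,
        (C.isDehomogenization_homogenizedD (i + 1)).strandPart_comm, dDeg_dDeg, map_zero]

variable {C}

theorem Minimal.toMultigraded (hC : C.Minimal) (hM : IsMonomialIdeal M) [Finite C.ι] :
    (C.toMultigraded hM).IsMinimal := by
  change ∀ i (b : {b // C.deg b = i + 1}) (c : {b // C.deg b = i}),
    ¬ IsUnit (C.homogenizedD i (Finsupp.single b 1) c)
  intro i b c hu
  obtain ⟨h1, h2⟩ := C.isDehomogenization_homogenizedD i b c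
  rw [h1] at hu
  have h3 := (hu.map (constantCoeff (σ := Fin n) (R := k))).ne_zero
  classical
  rw [constantCoeff_eq, coeff_monomial] at h3
  split_ifs at h3 with h
  · have hle := h2 h3
    -- A unit entry has nonzero constant term, which forces equal multidegrees, where minimality
    -- makes the scalar vanish.
    have heq : C.mdeg c.1 = C.mdeg b.1 := le_antisymm hle (tsub_eq_zero_iff_le.1 h)
    refine h3 ?_
    rw [fiberMap_apply, extendByZero_single, restrictTo_apply]
    exact hC _ _ heq
  · exact h3 rfl

end StrandResolution

end FromStrands

/-! ### From multigraded resolutions to strands. -/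

section ToStrands

variable {k : Type u} [Field k] {n : ℕ} {M : Ideal (MvPolynomial (Fin n) k)}

namespace MultigradedFreeResolution

variable (F : MultigradedFreeResolution M)

/-- The differential of the dehomogenized resolution in a single homological degree. -/
def dehomD (i : ℕ) : (F.ι (i + 1) →₀ k) →ₗ[k] (F.ι i →₀ k) :=
  (exists_isDehomogenization (F.d_homogeneous i)).choose

theorem isDehomogenization_dehomD (i : ℕ) :
    IsDehomogenization (F.mdeg (i + 1)) (F.mdeg i) (F.d i) (F.dehomD i) :=
  (exists_isDehomogenization (F.d_homogeneous i)).choose_spec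

/-- The dehomogenized augmentation. -/
def dehomAug : (F.ι 0 →₀ k) →ₗ[k] k :=
  Finsupp.linearCombination k fun b => (F.aug_homogeneous b).choose

theorem aug_eq (f : F.ι 0 →₀ MvPolynomial (Fin n) k) :
    F.aug f = M.mkQ (homogenizeFunctional (F.mdeg 0) F.dehomAug f) := by
  have : F.aug = M.mkQ ∘ₗ homogenizeFunctional (F.mdeg 0) F.dehomAug := by
    refine Finsupp.lhom_ext' fun b => LinearMap.ext_ring ?_
    simp only [LinearMap.comp_apply, Finsupp.lsingle_apply, homogenizeFunctional, dehomAug,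
      Finsupp.linearCombination_single, one_smul]
    exact (F.aug_homogeneous b).choose_spec
  rw [this, LinearMap.comp_apply]

/-- The scalars of `dehomAug` are not determined at multidegrees in `exponents M`, but only
components outside that set are tested. -/
theorem aug_eq_zero_iff (hM : IsMonomialIdeal M) (f : F.ι 0 →₀ MvPolynomial (Fin n) k) :
    F.aug f = 0 ↔ ∀ a, a ∉ exponents M → F.dehomAug (strandPart k (F.mdeg 0) a f) = 0 := by
  rw [aug_eq, Submodule.mkQ_apply, Submodule.Quotient.mk_eq_zero, hM.mem_iff]
  simp only [coeff_homogenizeFunctional]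

/-- The inclusion of the basis elements of homological degree `i`. -/
def incl (i : ℕ) : (F.ι i →₀ k) →ₗ[k] ((Σ i, F.ι i) →₀ k) :=
  Finsupp.lmapDomain k k (Sigma.mk i)

theorem incl_single (i : ℕ) (b : F.ι i) (r : k) :
    F.incl i (Finsupp.single b r) = Finsupp.single ⟨i, b⟩ r := by
  simp [incl, Finsupp.mapDomain_single]

theorem incl_injective (i : ℕ) : Function.Injective (F.incl i) :=
  Finsupp.mapDomain_injective sigma_mk_injective

theorem incl_apply (i : ℕ) (x : F.ι i →₀ k) (b : F.ι i) : F.incl i x ⟨i, b⟩ = x b :=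
  Finsupp.mapDomain_apply sigma_mk_injective x b

theorem incl_apply_ne {i : ℕ} {x : F.ι i →₀ k} {c : Σ i, F.ι i} (h : F.incl i x c ≠ 0) :
    ∃ b, c = ⟨i, b⟩ ∧ x b ≠ 0 := by
  by_cases hc : c ∈ Set.range (Sigma.mk i)
  · obtain ⟨b, rfl⟩ := hc
    exact ⟨b, rfl, by rwa [incl_apply] at h⟩
  · exact absurd (Finsupp.mapDomain_of_notMem_range x c hc) h

/-- The total differential of the dehomogenized resolution. -/
def totalD : ((Σ i, F.ι i) →₀ k) →ₗ[k] ((Σ i, F.ι i) →₀ k) :=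
  Finsupp.linearCombination k fun c => match c with
    | ⟨0, _⟩ => 0
    | ⟨i + 1, b⟩ => F.incl i (F.dehomD i (Finsupp.single b 1))

/-- The total augmentation of the dehomogenized resolution. -/
def totalAug : ((Σ i, F.ι i) →₀ k) →ₗ[k] k :=
  Finsupp.linearCombination k fun c => match c with
    | ⟨0, b⟩ => F.dehomAug (Finsupp.single b 1)
    | ⟨_ + 1, _⟩ => 0

theorem totalD_incl_zero (x : F.ι 0 →₀ k) : F.totalD (F.incl 0 x) = 0 := by
  rw [← LinearMap.comp_apply]
  refine eq_zero_of_single (fun b => ?_) x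
  simp [incl_single, totalD]

theorem totalD_incl (i : ℕ) (x : F.ι (i + 1) →₀ k) :
    F.totalD (F.incl (i + 1) x) = F.incl i (F.dehomD i x) := by
  rw [← LinearMap.comp_apply, ← LinearMap.comp_apply]
  refine hom_ext_single (fun b => ?_) x
  simp [incl_single, totalD]

theorem totalAug_incl (x : F.ι 0 →₀ k) : F.totalAug (F.incl 0 x) = F.dehomAug x := by
  rw [← LinearMap.comp_apply]
  refine hom_ext_single (fun b => ?_) x
  simp [incl_single, totalAug]

theorem dehomD_dehomD (i : ℕ) (x : F.ι (i + 2) →₀ k) :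
    F.dehomD i (F.dehomD (i + 1) x) = 0 := by
  rw [← LinearMap.comp_apply]
  refine eq_zero_of_single (fun b => ?_) x
  rw [LinearMap.comp_apply, ← strandPart_single (m := F.mdeg (i + 2)) b,
    ← (F.isDehomogenization_dehomD (i + 1)).strandPart_comm,
    ← (F.isDehomogenization_dehomD i).strandPart_comm,
    (F.exact_succ i _).2 ⟨_, rfl⟩, map_zero]

theorem dehomAug_dehomD (hM : IsMonomialIdeal M) (b : F.ι 1) (hb : F.mdeg 1 b ∉ exponents M) :
    F.dehomAug (F.dehomD 0 (Finsupp.single b 1)) = 0 := by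
  rw [← strandPart_single (m := F.mdeg 1) b,
    ← (F.isDehomogenization_dehomD 0).strandPart_comm]
  exact (F.aug_eq_zero_iff hM _).1 ((F.exact_zero _).2 ⟨_, rfl⟩) _ hb

theorem exists_dehomAug_eq_one (hM : IsMonomialIdeal M) {a : Fin n →₀ ℕ}
    (ha : a ∉ exponents M) :
    ∃ x ∈ Finsupp.supported k k {b | F.mdeg 0 b ≤ a}, F.dehomAug x = 1 := by
  obtain ⟨f, hf⟩ := F.aug_surjective (M.mkQ (monomial a 1))
  refine ⟨_, strandPart_mem f, ?_⟩
  rw [aug_eq, ← sub_eq_zero, ← map_sub, Submodule.mkQ_apply, Submodule.Quotient.mk_eq_zero,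
    hM.mem_iff] at hf
  have := hf a ha
  rw [coeff_sub, coeff_homogenizeFunctional, coeff_monomial, if_pos rfl, sub_eq_zero] at this
  exact this

theorem dehomD_exact_zero (hM : IsMonomialIdeal M) {a : Fin n →₀ ℕ} {x : F.ι 0 →₀ k}
    (hx : x ∈ Finsupp.supported k k {b | F.mdeg 0 b ≤ a})
    (hε : a ∉ exponents M → F.dehomAug x = 0) :
    ∃ y ∈ Finsupp.supported k k {b | F.mdeg 1 b ≤ a}, F.dehomD 0 y = x := by
  obtain ⟨f, hf⟩ := (F.exact_zero (homogenize k (F.mdeg 0) a x)).1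
    ((F.aug_eq_zero_iff hM _).2 fun a' ha' => by
      rw [strandPart_homogenize hx]
      split_ifs with h
      · exact hε (h ▸ ha')
      · exact map_zero _)
  refine ⟨_, strandPart_mem f, ?_⟩
  rw [← (F.isDehomogenization_dehomD 0).strandPart_comm, hf, strandPart_homogenize hx, if_pos rfl]

theorem dehomD_exact_succ {i : ℕ} {a : Fin n →₀ ℕ} {x : F.ι (i + 1) →₀ k}
    (hx : x ∈ Finsupp.supported k k {b | F.mdeg (i + 1) b ≤ a}) (hd : F.dehomD i x = 0) :
    ∃ y ∈ Finsupp.supported k k {b | F.mdeg (i + 2) b ≤ a}, F.dehomD (i + 1) y = x := by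
  obtain ⟨f, hf⟩ := (F.exact_succ i (homogenize k (F.mdeg (i + 1)) a x)).1
    (by rw [(F.isDehomogenization_dehomD i).map_homogenize hx, hd, map_zero])
  refine ⟨_, strandPart_mem f, ?_⟩
  rw [← (F.isDehomogenization_dehomD (i + 1)).strandPart_comm, hf, strandPart_homogenize hx,
    if_pos rfl]

/-- Dehomogenization of a multigraded free resolution. -/
def toStrands (hM : IsMonomialIdeal M) : StrandResolution k (exponents M) where
  ι := Σ i, F.ι i
  deg := Sigma.fst
  mdeg b := F.mdeg b.1 b.2
  d := F.totalD
  ε := F.totalAug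
  d_single := by
    rintro ⟨i, b⟩ c hc
    rw [← incl_single] at hc
    rcases i with _ | i
    · rw [totalD_incl_zero] at hc
      exact absurd rfl hc
    · rw [totalD_incl] at hc
      obtain ⟨c, rfl, hc'⟩ := F.incl_apply_ne hc
      exact ⟨rfl, (F.isDehomogenization_dehomD i b c).2 hc'⟩
  d_d x := by
    rw [← LinearMap.comp_apply]
    refine eq_zero_of_single ?_ x
    rintro ⟨i, b⟩
    rw [LinearMap.comp_apply, ← incl_single]
    rcases i with _ | _ | i
    · rw [totalD_incl_zero, map_zero]
    · rw [totalD_incl, totalD_incl_zero]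
    · rw [totalD_incl, totalD_incl, dehomD_dehomD, map_zero]
  ε_d := by
    rintro ⟨i, b⟩ hi hb
    obtain rfl : i = 1 := hi
    rw [← incl_single, totalD_incl, totalAug_incl]
    exact F.dehomAug_dehomD hM b hb
  ε_surjective a ha := by
    obtain ⟨x, hx, hx'⟩ := F.exists_dehomAug_eq_one hM ha
    refine ⟨F.incl 0 x, mem_strand.2 fun c hc => ?_, by rw [totalAug_incl, hx']⟩
    obtain ⟨b, rfl, hb⟩ := F.incl_apply_ne hc
    exact ⟨rfl, (Finsupp.mem_supported _ _).1 hx (by simpa using hb)⟩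
  exact i a x hx hd hε := by
    have incl_mem : ∀ {j} {y : F.ι j →₀ k},
        y ∈ Finsupp.supported k k {b | F.mdeg j b ≤ a} →
        F.incl j y ∈ strand k Sigma.fst (fun b : Σ i, F.ι i => F.mdeg b.1 b.2) j a := by
      intro j y hy
      refine mem_strand.2 fun c hc => ?_
      obtain ⟨b, rfl, hb⟩ := F.incl_apply_ne hc
      exact ⟨rfl, (Finsupp.mem_supported _ _).1 hy (by simpa using hb)⟩
    have hx0 : x ∈ (Finsupp.supported k k {b | F.mdeg i b ≤ a}).map (F.incl i) := by
      refine strand_le ?_ hx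
      rintro ⟨j, b⟩ hj hb
      obtain rfl : j = i := hj
      exact ⟨Finsupp.single b 1, Finsupp.single_mem_supported k 1 hb, F.incl_single _ _ _⟩
    obtain ⟨x, hx1, rfl⟩ := hx0
    rcases i with _ | i
    · obtain ⟨y, hy, hy'⟩ := F.dehomD_exact_zero hM hx1
        (fun ha => by simpa [totalAug_incl] using hε rfl ha)
      exact ⟨F.incl 1 y, incl_mem hy, by rw [totalD_incl, hy']⟩
    · rw [totalD_incl] at hd
      obtain ⟨y, hy, hy'⟩ := F.dehomD_exact_succ hx1
        (F.incl_injective i (hd.trans (map_zero _).symm))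
      exact ⟨F.incl (i + 2) y, incl_mem hy, by rw [totalD_incl, hy']⟩

theorem IsMinimal.toStrands {F : MultigradedFreeResolution M} (hF : F.IsMinimal)
    (hM : IsMonomialIdeal M) : (F.toStrands hM).Minimal := by
  change ∀ b c : (Σ i, F.ι i), F.mdeg c.1 c.2 = F.mdeg b.1 b.2 →
    F.totalD (Finsupp.single b 1) c = 0
  rintro ⟨i, b⟩ c hbc
  by_contra hne
  rw [← incl_single] at hne
  rcases i with _ | i
  · rw [totalD_incl_zero] at hne
    exact hne rfl
  · rw [totalD_incl] at hne
    obtain ⟨c, rfl, hc⟩ := F.incl_apply_ne hne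
    have heq : F.mdeg i c = F.mdeg (i + 1) b := hbc
    refine hF i b c ?_
    rw [(F.isDehomogenization_dehomD i b c).1, heq, tsub_self]
    exact (isUnit_iff_ne_zero.2 hc).map C

end MultigradedFreeResolution

end ToStrands

/-! ### Toggling a generator among the sets with a given lcm. -/

section Combinatorics

variable {σ V : Type*}

theorem sup_eq_iff {g : V → σ →₀ ℕ} {T : Finset V} {l : σ →₀ ℕ} :
    T.sup g = l ↔ (∀ v ∈ T, g v ≤ l) ∧ ∀ j, l j ≠ 0 → ∃ v ∈ T, g v j = l j := by
  classical
  constructor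
  · intro h
    have hle : ∀ v ∈ T, g v ≤ l := fun v hv => h ▸ Finset.le_sup hv
    refine ⟨hle, fun j hj => ?_⟩
    by_contra hne
    push Not at hne
    -- If no member of `T` attained the exponent `l j`, it could be lowered by one and still bound
    -- `T`.
    have h1 : T.sup g ≤ l - Finsupp.single j 1 := by
      refine Finset.sup_le fun v hv j' => ?_
      have h2 := hle v hv j'
      rw [Finsupp.tsub_apply]
      by_cases hjj : j = j'
      · subst hjj
        have := hne v hv
        rw [Finsupp.single_eq_same]
        omega
      · rw [Finsupp.single_eq_of_ne' hjj]
        exact h2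
    rw [h] at h1
    have h3 := h1 j
    rw [Finsupp.tsub_apply, Finsupp.single_eq_same] at h3
    omega
  · rintro ⟨hle, h⟩
    refine le_antisymm (Finset.sup_le hle) fun j => ?_
    by_cases hj : l j = 0
    · rw [hj]
      exact Nat.zero_le _
    · obtain ⟨v, hv, hvj⟩ := h j hj
      rw [← hvj]
      exact Finset.le_sup (f := g) hv j

/-- If all variables except `x_i` have pairwise distinct nonzero exponents in the monomials `g v`,
then toggling some `v` preserves the sets with least common multiple `l`, up to one exception. -/
theorem exists_toggle [Fintype V] [DecidableEq V] {g : V → σ →₀ ℕ} {i : σ}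
    (hgen : ∀ j, j ≠ i → ∀ v w, v ≠ w → g v j ≠ 0 → g v j ≠ g w j) (l : σ →₀ ℕ) :
    (∃ T₀ : Finset V, ∀ T : Finset V, T.sup g = l → T = T₀) ∨
      ∃ (v : V) (T₀ : Finset V), ∀ T : Finset V, T.sup g = l → T ≠ T₀ →
        if v ∈ T then (T.erase v).sup g = l else (insert v T).sup g = l := by
  classical
  by_cases hex : ∃ T : Finset V, T.sup g = l
  swap
  · exact Or.inl ⟨∅, fun T hT => absurd ⟨T, hT⟩ hex⟩
  -- The forced generators: by genericity each is the only one with its exponent in the variable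
  -- `j`, so every `T` with lcm `l` contains it. Together they already attain `l` in all variables
  -- except `i`.
  let A : Finset V := Finset.univ.filter fun v => g v ≤ l ∧ ∃ j, j ≠ i ∧ l j ≠ 0 ∧ g v j = l j
  have memA : ∀ v, v ∈ A ↔ g v ≤ l ∧ ∃ j, j ≠ i ∧ l j ≠ 0 ∧ g v j = l j := by simp [A]
  have hA : ∀ T : Finset V, T.sup g = l → A ⊆ T := by
    intro T hT v hv
    obtain ⟨-, j, hji, hj, hvj⟩ := (memA v).1 hv
    obtain ⟨w, hw, hwj⟩ := (sup_eq_iff.1 hT).2 j hj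
    by_contra hvT
    exact hgen j hji v w (fun h => hvT (h ▸ hw)) (hvj ▸ hj) (hvj.trans hwj.symm)
  have cover : ∀ j, j ≠ i → l j ≠ 0 → ∃ v ∈ A, g v j = l j := by
    intro j hji hj
    obtain ⟨T, hT⟩ := hex
    obtain ⟨hle, h⟩ := sup_eq_iff.1 hT
    obtain ⟨v, hv, hvj⟩ := h j hj
    exact ⟨v, (memA v).2 ⟨hle v hv, j, hji, hj, hvj⟩, hvj⟩
  have hinsert : ∀ v, g v ≤ l → ∀ T : Finset V, T.sup g = l → (insert v T).sup g = l := by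
    intro v hv T hT
    rw [Finset.sup_insert, hT, sup_eq_right.2 hv]
  by_cases hout : ∃ v, g v ≤ l ∧ v ∉ A
  swap
  · push Not at hout
    exact Or.inl ⟨A, fun T hT => Finset.Subset.antisymm
      (fun v hv => hout v ((sup_eq_iff.1 hT).1 v hv)) (hA T hT)⟩
  right
  -- Is there an unforced divisor of `l` that does not attain a nonzero exponent of `l` in any
  -- variable? Such a generator can be toggled freely, with `∅` below as a dummy exception.
  by_cases hc : ∃ v, g v ≤ l ∧ v ∉ A ∧ (l i ≠ 0 → g v i ≠ l i)
  · obtain ⟨v, hvl, hvA, hvi⟩ := hc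
    refine ⟨v, ∅, fun T hT _ => ?_⟩
    split_ifs with hvT
    · obtain ⟨hle, h⟩ := sup_eq_iff.1 hT
      refine sup_eq_iff.2 ⟨fun w hw => hle w (Finset.mem_of_mem_erase hw), fun j hj => ?_⟩
      obtain ⟨w, hw, hwj⟩ := h j hj
      refine ⟨w, Finset.mem_erase.2 ⟨?_, hw⟩, hwj⟩
      rintro rfl
      by_cases hji : j = i
      · subst hji
        exact hvi hj hwj
      · exact hvA ((memA w).2 ⟨hvl, j, hji, hj, hwj⟩)
    · exact hinsert v hvl T hT
  · push Not at hc
    obtain ⟨e, hel, heA⟩ := hout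
    -- Now every unforced divisor attains `l i`. Removing `e` is harmless as soon as `T` has another
    -- unforced member, so only `insert e A` can be exceptional.
    refine ⟨e, insert e A, fun T hT hne => ?_⟩
    split_ifs with heT
    · obtain ⟨hle, h⟩ := sup_eq_iff.1 hT
      refine sup_eq_iff.2 ⟨fun w hw => hle w (Finset.mem_of_mem_erase hw), fun j hj => ?_⟩
      by_cases hji : j = i
      · subst hji
        have hsub : insert e A ⊆ T := Finset.insert_subset heT (hA T hT)
        obtain ⟨w, hwT, hw⟩ := Finset.exists_of_ssubset (hsub.ssubset_of_ne hne.symm)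
        rw [Finset.mem_insert, not_or] at hw
        exact ⟨w, Finset.mem_erase.2 ⟨hw.1, hwT⟩, (hc w (hle w hwT) hw.2).2⟩
      · obtain ⟨w, hw, hwj⟩ := cover j hji hj
        exact ⟨w, Finset.mem_erase.2 ⟨fun h => heA (h ▸ hw), hA T hT hw⟩, hwj⟩
    · exact hinsert e hel T hT

end Combinatorics

/-! ### Indexing the minimal generators and the Taylor count. -/

section Generators

variable {k : Type u} [Field k] {n : ℕ} (M : Ideal (MvPolynomial (Fin n) k))

/-- An enumeration of the minimal generators. -/
def generator (v : Fin (minimalGenerators M).card) : Fin n →₀ ℕ :=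
  ((minimalGenerators M).equivFin.symm v).1

theorem generator_injective : Function.Injective (generator M) :=
  Subtype.val_injective.comp (minimalGenerators M).equivFin.symm.injective

theorem generator_mem (v : Fin (minimalGenerators M).card) :
    generator M v ∈ minimalGenerators M :=
  ((minimalGenerators M).equivFin.symm v).2

variable {M}

theorem mem_minimalGenerators {a : Fin n →₀ ℕ} :
    a ∈ minimalGenerators M ↔ Minimal (· ∈ exponents M) a := by
  simp [minimalGenerators, exponents]

theorem exists_generator_eq {a : Fin n →₀ ℕ} (ha : a ∈ minimalGenerators M) :
    ∃ v, generator M v = a :=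
  ⟨(minimalGenerators M).equivFin ⟨a, ha⟩, by simp [generator]⟩

theorem exists_generator_le {a : Fin n →₀ ℕ} (ha : a ∈ exponents M) :
    ∃ v, generator M v ≤ a := by
  obtain ⟨b, hba, hb⟩ := exists_minimal_le_of_wellFoundedLT (· ∈ exponents M) a ha
  obtain ⟨v, rfl⟩ := exists_generator_eq (mem_minimalGenerators.2 hb)
  exact ⟨v, hba⟩

/-- Faces are indexed by `Fin` because the signs of the Taylor complex require a linear order on the
vertices. -/
theorem taylorCount_eq (l : Fin n →₀ ℕ) :
    taylorCount M l =
      Nat.card {T : Finset (Fin (minimalGenerators M).card) // T.sup (generator M) = l} := by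
  classical
  rw [Nat.card_eq_fintype_card, Fintype.card_subtype, taylorCount]
  symm
  refine Finset.card_bij (fun T _ => T.map ⟨generator M, generator_injective M⟩) ?_ ?_ ?_
  · intro T hT
    rw [Finset.mem_filter] at hT ⊢
    refine ⟨Finset.mem_powerset.2 fun a ha => ?_, ?_⟩
    · obtain ⟨v, -, rfl⟩ := Finset.mem_map.1 ha
      exact generator_mem M v
    · rw [taylorMultidegree, Finset.sup_map]
      exact hT.2
  · intro T _ T' _ h
    exact Finset.map_injective _ h
  · intro S hS
    rw [Finset.mem_filter, Finset.mem_powerset] at hS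
    have hS' : (Finset.univ.filter fun v => generator M v ∈ S).map
        ⟨generator M, generator_injective M⟩ = S := by
      ext a
      simp only [Finset.mem_map, Finset.mem_filter, Finset.mem_univ, true_and,
        Function.Embedding.coeFn_mk]
      constructor
      · rintro ⟨v, hv, rfl⟩
        exact hv
      · intro ha
        obtain ⟨v, rfl⟩ := exists_generator_eq (hS.1 ha)
        exact ⟨v, ha, rfl⟩
    refine ⟨_, Finset.mem_filter.2 ⟨Finset.mem_univ _, ?_⟩, hS'⟩
    rw [← hS.2]
    conv_rhs => rw [← hS', taylorMultidegree, Finset.sup_map]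
    rfl

end Generators

/-- With at most one basis element of multidegree `l` in all homological degrees together, at most
one summand is nonzero. -/
theorem MultigradedFreeResolution.hasSum_betti {k : Type u} [Field k] {n : ℕ}
    {M : Ideal (MvPolynomial (Fin n) k)} (F : MultigradedFreeResolution M) (l : Fin n →₀ ℕ)
    [Finite {b : Σ i, F.ι i // F.mdeg b.1 b.2 = l}]
    (h : Nat.card {b : Σ i, F.ι i // F.mdeg b.1 b.2 = l} ≤ 1) :
    HasSum (fun i => F.betti i l) (Nat.card {b : Σ i, F.ι i // F.mdeg b.1 b.2 = l}) := by
  have hsub := Finite.card_le_one_iff_subsingleton.1 h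
  rcases isEmpty_or_nonempty {b : Σ i, F.ι i // F.mdeg b.1 b.2 = l} with he | ⟨⟨⟨i, b⟩, hb⟩⟩
  · rw [Nat.card_of_isEmpty]
    convert hasSum_zero with i
    have := F.finite i
    rw [betti, Set.ncard_eq_zero (Set.toFinite _)]
    exact Set.eq_empty_of_forall_notMem fun b hb => he.elim ⟨⟨i, b⟩, hb⟩
  · have huniq : ∀ j (c : F.ι j), F.mdeg j c = l → (⟨j, c⟩ : Σ i, F.ι i) = ⟨i, b⟩ :=
      fun j c hc => congrArg Subtype.val (hsub.elim ⟨⟨j, c⟩, hc⟩ ⟨⟨i, b⟩, hb⟩)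
    have h1 : Nat.card {b : Σ i, F.ι i // F.mdeg b.1 b.2 = l} = F.betti i l := by
      have h2 : {c : F.ι i | F.mdeg i c = l} = {b} := by
        ext c
        constructor
        · intro hc
          exact sigma_mk_injective (huniq i c hc)
        · rintro rfl
          exact hb
      rw [betti, h2, Set.ncard_singleton]
      have : Nonempty {b : Σ i, F.ι i // F.mdeg b.1 b.2 = l} := ⟨⟨⟨i, b⟩, hb⟩⟩
      exact le_antisymm h Finite.card_pos
    rw [h1]
    refine hasSum_single i fun j hj => ?_
    have := F.finite j
    rw [betti, Set.ncard_eq_zero (Set.toFinite _)]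
    exact Set.eq_empty_of_forall_notMem fun c hc => hj (congrArg Sigma.fst (huniq j c hc))

end

theorem corollary4 {k : Type*} [Field k] {n : ℕ} (M : Ideal (MvPolynomial (Fin n) k))
    (hM : IsMonomialIdeal M) (hgen : IsAlmostGeneric M) :
    HasCharacteristicBettiNumbers M := by
  have hg : ∀ v, generator M v ∈ exponents M :=
    fun v => (mem_minimalGenerators.1 (generator_mem M v)).1
  have hU' : ∀ a ∈ exponents M, ∃ v, generator M v ≤ a := fun a ha => exists_generator_le ha
  constructor
  · let T := taylorResolution k (generator M) (exponents M) hg isUpperSet_exponents hU'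
    have : Finite T.ι := inferInstanceAs (Finite (Finset (Fin (minimalGenerators M).card)))
    obtain ⟨C, hfin, hC⟩ := StrandResolution.exists_minimal isUpperSet_exponents T
    exact ⟨C.toMultigraded hM, hC.toMultigraded hM⟩
  · intro F hF l
    obtain ⟨i, hi⟩ := hgen
    have hp := exists_toggle (g := generator M) (i := i)
      (fun j hj v w hvw => hi j hj _ (generator_mem M v) _ (generator_mem M w)
        fun h => hvw (generator_injective M h)) l
    obtain ⟨hfin, hle, r, hr⟩ := (hF.toStrands hM).card_fiber hg isUpperSet_exponents hU' l hp
    have hfin' : Finite {b : Σ i, F.ι i // F.mdeg b.1 b.2 = l} := hfin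
    convert F.hasSum_betti l hle using 1
    rw [taylorCount_eq, hr]
    change (if Odd (Nat.card {b : Σ i, F.ι i // F.mdeg b.1 b.2 = l} + 2 * r) then 1 else 0) =
      Nat.card {b : Σ i, F.ι i // F.mdeg b.1 b.2 = l}
    have hle' : Nat.card {b : Σ i, F.ι i // F.mdeg b.1 b.2 = l} ≤ 1 := hle
    -- The Betti total is at most 1 and differs from the Taylor count by `2 * r`, so it equals the
    -- parity of that count.
    split_ifs with hodd
    · obtain ⟨s, hs⟩ := hodd
      omega
    · rw [Nat.not_odd_iff_even] at hodd
      obtain ⟨s, hs⟩ := hodd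
      omega
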